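/- **Theorem.** Let $n$, $d\ge 1$ and the points $x_1,\dots,x_n\in S^{d-1}$ (unit vectors of $\mathbb R^d$) depend on an implicit parameter, in such a way that $n\to\infty$ and $d\to\infty$. Assume that for every fixed $\varepsilon>0$, $$\sum_{\substack{1\le i<j\le n\\ |\langle x_i,x_j\rangle|\ge\varepsilon}}\min\left(\frac{1}{\sqrt{1-|\langle x_i,x_j\rangle|}},\,n\right)=o(n^2),$$ where the minimum is read as $n$ if $|\langle x_i,x_j\rangle|=1$. Let $U$ be uniformly distributed on $S^{d-1}$ and, for $a\in\mathbb R$, consider the point process on $\mathbb R$ $$\xi_a=\xi_a(U)=\sum_{j=1}^n\delta_{\,n(\langle x_j,\sqrt d\,U\rangle-a)} .$$ Then for every fixed $a\in\mathbb R$, $\xi_a$ converges to the homogeneous Poisson process with intensity $\phi(a)=(2\pi)^{-1/2}e^{-a^2/2}$ in the following sense: for every fixed bounded Borel set $I\subset\mathbb R$, the random variable $\xi_a(I)$, that is, the number of $j$ with $n(\langle x_j,\sqrt d\,U\rangle-a)\in I$, converges in distribution to $\mathrm{Pois}(\phi(a)\operatorname{mes} I)$, where $\operatorname{mes}$ is Lebesgue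 measure and $\mathrm{Pois}(0)$ is the unit mass at $0$. -/

import Mathlib

open Filter MeasureTheory ProbabilityTheory Asymptotics

/-- The unit sphere `S^{d-1}` in the Euclidean space `ℝ^d`. -/
abbrev UnitSphere (d : ℕ) : Type :=
  Metric.sphere (0 : EuclideanSpace ℝ (Fin d)) 1

/-- The inner product of two points of the sphere. -/
noncomputable def sphereInner {d : ℕ} (x y : UnitSphere d) : ℝ :=
  inner ℝ (x : EuclideanSpace ℝ (Fin d)) (y : EuclideanSpace ℝ (Fin d))

/-- The uniform probability measure on `S^{d-1}`: the surface measure, divided by its total mass. -/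
noncomputable def uniformSphere (d : ℕ) : Measure (UnitSphere d) :=
  ((volume : Measure (EuclideanSpace ℝ (Fin d))).toSphere Set.univ)⁻¹ •
    (volume : Measure (EuclideanSpace ℝ (Fin d))).toSphere

instance uniformSphere_isProbabilityMeasure (d : ℕ) [NeZero d] :
    IsProbabilityMeasure (uniformSphere d) := by
  have : Nonempty (Fin d) := ⟨0⟩
  have : Nontrivial (EuclideanSpace ℝ (Fin d)) := inferInstance
  have : NeZero (volume : Measure (EuclideanSpace ℝ (Fin d))).toSphere :=
    ⟨Measure.toSphere_ne_zero _⟩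
  unfold uniformSphere
  infer_instance

/-- The point process `ξ_a(u) = ∑_j δ(• - n(⟨x_j, √d u⟩ - a))`, a Borel measure on `ℝ`
depending on the direction `u`. Here `⟨x_j, √d u⟩ = √d ⟨x_j, u⟩`. -/
noncomputable def projectionProcess {n d : ℕ} (x : Fin n → UnitSphere d) (a : ℝ)
    (u : UnitSphere d) : Measure ℝ :=
  ∑ j, Measure.dirac ((n : ℝ) * (√(d : ℝ) * sphereInner (x j) u - a))

/-- On Borel sets, `ξ_a` counts the rescaled projections. -/
theorem projectionProcess_real_apply {n d : ℕ} (x : Fin n → UnitSphere d) (a : ℝ)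
    (u : UnitSphere d) {I : Set ℝ} (hI : MeasurableSet I) :
    (projectionProcess x a u).real I =
      (({j : Fin n | (n : ℝ) * (√(d : ℝ) * sphereInner (x j) u - a) ∈ I} : Set (Fin n)).ncard
        : ℝ) := by
  classical
  rw [Measure.real, projectionProcess, Measure.finsetSum_apply,
    ENNReal.toReal_sum (fun j _ => measure_ne_top _ _), Set.ncard_eq_toFinset_card',
    Set.toFinset_ofPred, Finset.card_filter]
  push_cast
  refine Finset.sum_congr rfl fun j _ => ?_
  rw [Measure.dirac_apply' _ hI, Set.indicator_apply]
  split_ifs <;> simp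

/-- `min (1 / √(1 - |t|), n)` for `|t| ≤ 1`, where `1 / √0 = +∞`, so that the value at `|t| = 1`
is `n`. -/
noncomputable def pairWeight (n : ℕ) (t : ℝ) : ℝ :=
  if |t| < 1 then min (1 / √(1 - |t|)) (n : ℝ) else (n : ℝ)

/-- The sum of `min (1 / √(1 - |⟨x_i, x_j⟩|), n)` over the pairs `i < j` with
`|⟨x_i, x_j⟩| ≥ ε`. -/
noncomputable def correlationSum {n d : ℕ} (x : Fin n → UnitSphere d) (ε : ℝ) : ℝ :=
  open scoped Classical in
  ∑ p : Fin n × Fin n with p.1 < p.2 ∧ ε ≤ |sphereInner (x p.1) (x p.2)|,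
    pairWeight n (sphereInner (x p.1) (x p.2))

/-! Write `t_j = n (√d ⟨x_j, U⟩ - a)`, `N = ξ_a(I)` and `r = φ(a) mes I`. The Poisson law of mean
`r` is the only probability law on `ℕ` with `(m + 1) p(m + 1) = r p(m)` for all `m`. It therefore
suffices to prove this recursion asymptotically, together with tightness (`tendsto_poisson_weight`).
Only one-point and two-point estimates are needed, which is what a hypothesis on pairs can supply;
no higher moments are computed.

The left side `(m + 1) P(N = m + 1)` equals `∑_j P(t_j ∈ I, N = m + 1)`. Fix `j` and slice the
sphere orthogonally to `x_j`. The height `z = √d ⟨x_j, U⟩` has an explicit density that tends to the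
Gaussian one, and given `z` the direction inside the slice is uniform on a sphere of one dimension
less (`exists_slice_projection`). Moving `z` by `s / n` changes the density by `o(1)`, and it moves
the bounded heights of points almost orthogonal to `x_j` by `o(1 / n)`. Hence replacing `t_j ∈ I` by
`t_j + s ∈ I` hardly changes the joint law with the number of hits by those points
(`exists_forall_shift_le`). When `I` and `I - s` are disjoint, both `t_j ∈ I, N = m + 1` and `t_j ∈
I - s, N = m` say that the other points make `m` hits. So the sum is close to the integral of `ξ_a(I
- s)` over `{N = m}` (`tendsto_succ_mul_sub_sum`).

Now average over `L` shifts whose translates of `I` are disjoint. Each translate is hit `r` times on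
average in the limit, and distinct translates have covariance at most `o(1)`, so the average of the
counts is at `L²` distance about `√(r / L)` from `r`. The integral over `{N = m}` becomes `r P(N =
m)`, which is the recursion (`tendsto_succ_mul_sub`).

Points not almost orthogonal to `x_j` are discarded throughout. Given `z`, the height of a point
with `⟨x_i, x_j⟩ = ρ` has density `O(1 / √(1 - |ρ|))`, so such a pair hits with probability `O(n⁻²
min(1 / √(1 - |ρ|), n))`. The hypothesis says that these probabilities sum to `o(1)`
(`tendsto_badPairs`). -/

/-! ### Polar and tangent coordinates on the sphere -/

theorem lintegral_comp_mul_left_real (f : ℝ → ENNReal) {a : ℝ} (ha : a ≠ 0) :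
    ∫⁻ x, f (a * x) = ENNReal.ofReal |a⁻¹| * ∫⁻ x, f x := by
  have h := lintegral_map_equiv f (Homeomorph.mulLeft₀ a ha).toMeasurableEquiv (μ := volume)
  have h2 : Measure.map (Homeomorph.mulLeft₀ a ha).toMeasurableEquiv volume
      = ENNReal.ofReal |a⁻¹| • (volume : Measure ℝ) := Real.map_volume_mul_left ha
  rw [h2, lintegral_smul_measure] at h
  exact h.symm

theorem lintegral_polar {E : Type*} [NormedAddCommGroup E] [NormedSpace ℝ E] [MeasurableSpace E]
    [BorelSpace E] [FiniteDimensional ℝ E] [Nontrivial E] (μ : Measure E) [μ.IsAddHaarMeasure]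
    {G : E → ENNReal} (hG : Measurable G) :
    ∫⁻ x, G x ∂μ = ∫⁻ u : Metric.sphere (0 : E) 1, (∫⁻ r in Set.Ioi (0 : ℝ),
      ENNReal.ofReal (r ^ (Module.finrank ℝ E - 1)) * G (r • (u : E))) ∂μ.toSphere := by
  calc ∫⁻ x, G x ∂μ = ∫⁻ x in ({0}ᶜ : Set E), G x ∂μ := by rw [restrict_compl_singleton]
    _ = ∫⁻ x : ({0}ᶜ : Set E), G x ∂(μ.comap (↑)) :=
        (lintegral_subtype_comap (measurableSet_singleton _).compl _).symm
    _ = ∫⁻ p, G ((p.2 : ℝ) • (p.1 : E)) ∂(μ.toSphere.prod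
          (.volumeIoiPow (Module.finrank ℝ E - 1))) := by
        rw [← μ.measurePreserving_homeomorphUnitSphereProd.lintegral_comp_emb
          (Homeomorph.measurableEmbedding _)]
        refine lintegral_congr fun x => ?_
        have hx : (x : E) ≠ 0 := x.2
        simp [smul_smul, hx]
    _ = _ := by
        have hm : Measurable fun p : Metric.sphere (0 : E) 1 × Set.Ioi (0 : ℝ) =>
            G ((p.2 : ℝ) • (p.1 : E)) := hG.comp (by fun_prop)
        rw [lintegral_prod _ hm.aemeasurable]
        refine lintegral_congr fun u => ?_
        have hu : Measurable fun r : Set.Ioi (0 : ℝ) => G ((r : ℝ) • (u : E)) :=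
          hG.comp (by fun_prop)
        refine (lintegral_withDensity_eq_lintegral_mul _ (by fun_prop) hu).trans ?_
        exact lintegral_subtype_comap measurableSet_Ioi fun r : ℝ =>
          ENNReal.ofReal (r ^ (Module.finrank ℝ E - 1)) * G (r • (u : E))

/-- A function of the direction times a function of the norm factorises in polar coordinates. This
turns a sphere integral into a Lebesgue integral, to which Fubini along `e` and its orthogonal
complement applies. -/
theorem lintegral_normalize {E : Type*} [NormedAddCommGroup E] [NormedSpace ℝ E]
    [MeasurableSpace E]
    [BorelSpace E] [FiniteDimensional ℝ E] [Nontrivial E] (μ : Measure E) [μ.IsAddHaarMeasure]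
    {G : E → ENNReal} (hG : Measurable G) {h : ℝ → ENNReal} (hh : Measurable h) :
    ∫⁻ x, G (‖x‖⁻¹ • x) * h ‖x‖ ∂μ = (∫⁻ u, G u ∂μ.toSphere) *
      ∫⁻ r in Set.Ioi (0 : ℝ), ENNReal.ofReal (r ^ (Module.finrank ℝ E - 1)) * h r := by
  rw [lintegral_polar μ (by fun_prop), ← lintegral_mul_const _ (by fun_prop)]
  refine lintegral_congr fun u => ?_
  rw [← lintegral_const_mul _ (by fun_prop)]
  refine setLIntegral_congr_fun measurableSet_Ioi fun r hr => ?_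
  have hr : 0 < r := hr
  have : ‖r • (u : E)‖ = r := by simp [norm_smul, hr.le]
  simp only [this, smul_smul, inv_mul_cancel₀ hr.ne', one_smul]
  ring

/-- Coordinates adapted to a unit vector `e`. -/
theorem exists_orthogonal_slice {m : ℕ} (e : UnitSphere (m + 1)) :
    ∃ ι : EuclideanSpace ℝ (Fin m) →ₗᵢ[ℝ] EuclideanSpace ℝ (Fin (m + 1)),
      (∀ w, inner ℝ (e : EuclideanSpace ℝ (Fin (m + 1))) (ι w) = 0) ∧
      (∀ x, ∃ w, x = inner ℝ (e : EuclideanSpace ℝ (Fin (m + 1))) x • e.1 + ι w) ∧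
      MeasurePreserving (fun p : ℝ × EuclideanSpace ℝ (Fin m) => p.1 • e.1 + ι p.2) := by
  have he : ‖e.1‖ = 1 := by simp
  obtain ⟨b, hb⟩ := Orthonormal.exists_orthonormalBasis_extension_of_card_eq (𝕜 := ℝ)
    (E := EuclideanSpace ℝ (Fin (m + 1))) (ι := Fin (m + 1)) (by simp) (v := fun _ => e.1)
    (s := {0})
    (by
      constructor
      · intro i; simp
      · intro i j hij; exact absurd (Subsingleton.elim i j) hij)
  have hb0 : b 0 = e.1 := hb 0 rfl
  let c : ℝ × EuclideanSpace ℝ (Fin m) → EuclideanSpace ℝ (Fin (m + 1)) :=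
    fun p => WithLp.toLp 2 (Fin.cons p.1 p.2.ofLp : Fin (m + 1) → ℝ)
  let ι₀ : EuclideanSpace ℝ (Fin m) →ₗ[ℝ] EuclideanSpace ℝ (Fin (m + 1)) :=
    { toFun := fun w => c (0, w)
      map_add' := fun v w => by
        ext i; refine Fin.cases ?_ (fun j => ?_) i <;> simp [c]
      map_smul' := fun r w => by
        ext i; refine Fin.cases ?_ (fun j => ?_) i <;> simp [c] }
  let ι₁ : EuclideanSpace ℝ (Fin m) →ₗᵢ[ℝ] EuclideanSpace ℝ (Fin (m + 1)) :=
    ⟨ι₀, fun w => by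
      simp [EuclideanSpace.norm_eq, Fin.sum_univ_succ, ι₀, c]⟩
  have hdec : ∀ p : ℝ × EuclideanSpace ℝ (Fin m),
      p.1 • e.1 + b.repr.symm (ι₁ p.2) = b.repr.symm (c p) := by
    intro p
    apply b.repr.injective
    rw [map_add, map_smul, ← hb0]
    simp only [LinearIsometryEquiv.apply_symm_apply]
    ext i; refine Fin.cases ?_ (fun j => ?_) i <;>
      simp [c, ι₁, ι₀]
  refine ⟨b.repr.symm.toLinearIsometry.comp ι₁, fun w => ?_, fun x => ?_, ?_⟩
  · rw [← hb0]
    change inner ℝ (b 0) (b.repr.symm (ι₁ w)) = 0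
    rw [← b.repr_apply_apply]
    simp [ι₁, ι₀, c]
  · refine ⟨WithLp.toLp 2 fun j => b.repr x j.succ, ?_⟩
    change x = _ • e.1 + b.repr.symm (ι₁ _)
    have := hdec (inner ℝ e.1 x, WithLp.toLp 2 fun j => b.repr x j.succ)
    simp only at this
    rw [this]
    apply b.repr.injective
    rw [LinearIsometryEquiv.apply_symm_apply]
    ext i; refine Fin.cases ?_ (fun j => ?_) i
    · simp [c, ← hb0, b.repr_apply_apply]
    · simp [c]
  · have h1 : MeasurePreserving c := by
      have h2 := (volume_preserving_piFinSuccAbove (fun _ : Fin (m + 1) => ℝ) 0).symm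
      have h3 : MeasurePreserving
          (Prod.map (id : ℝ → ℝ) (WithLp.ofLp : EuclideanSpace ℝ (Fin m) → _)) :=
        (MeasurePreserving.id volume).prod (PiLp.volume_preserving_ofLp (Fin m))
      convert (PiLp.volume_preserving_toLp (Fin (m + 1))).comp (h2.comp h3) using 1
      funext p
      simp [c, MeasurableEquiv.piFinSuccAbove, Fin.insertNthEquiv]
    have h4 := b.measurePreserving_repr_symm.comp h1
    change MeasurePreserving (fun p : ℝ × EuclideanSpace ℝ (Fin m) =>
      p.1 • e.1 + b.repr.symm (ι₁ p.2)) volume volume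
    rw [funext hdec]
    exact h4

/-- Substitute `c = z / √(D - z²)`. Then `1 / √(1 + c²) = √(1 - z² / D)` and `dc = D^(-1/2) (1 - z²
/ D)^(-3/2) dz`, so the Jacobian lowers the exponent from `k + 3` to `k`. -/
theorem lintegral_tangent_subst {D : ℝ} (hD : 0 < D) {k : ℕ} (hk : k ≠ 0)
    (H : ℝ → ℝ → ENNReal) :
    ∫⁻ c : ℝ, ENNReal.ofReal ((√(1 + c ^ 2))⁻¹ ^ (k + 3)) *
      H (c * (√(1 + c ^ 2))⁻¹) (√(1 + c ^ 2))⁻¹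
      = ENNReal.ofReal (√D)⁻¹ *
        ∫⁻ z : ℝ, ENNReal.ofReal (√(1 - z ^ 2 / D) ^ k) * H (z / √D) √(1 - z ^ 2 / D) := by
  have hs : 0 < √D := Real.sqrt_pos.2 hD
  set s : Set ℝ := Set.Ioo (-√D) √D
  have hlt : ∀ z ∈ s, 0 < D - z ^ 2 := fun z hz => by
    have := Real.sq_sqrt hD.le
    nlinarith [hz.1, hz.2]
  let f : ℝ → ℝ := fun z => z / √(D - z ^ 2)
  have hsq : ∀ z ∈ s, 1 + f z ^ 2 = D / (D - z ^ 2) := fun z hz => by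
    have h := hlt z hz
    simp only [f, div_pow, Real.sq_sqrt h.le]
    field_simp; ring
  have hq : ∀ z ∈ s, (√(1 + f z ^ 2))⁻¹ = √(D - z ^ 2) / √D := fun z hz => by
    rw [hsq z hz, Real.sqrt_div hD.le, inv_div]
  have hr : ∀ z ∈ s, √(1 - z ^ 2 / D) = √(D - z ^ 2) / √D := fun z hz => by
    rw [← Real.sqrt_div (hlt z hz).le]; congr 1; field_simp
  have himg : f '' s = Set.univ := by
    refine Set.eq_univ_of_forall fun c => ?_
    have hc : 0 < 1 + c ^ 2 := by positivity
    have hcs : 0 < √(1 + c ^ 2) := Real.sqrt_pos.2 hc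
    have hz2 : D - (√D * c / √(1 + c ^ 2)) ^ 2 = D / (1 + c ^ 2) := by
      rw [div_pow, mul_pow, Real.sq_sqrt hD.le, Real.sq_sqrt hc.le]; field_simp; ring
    have habs : |c| < √(1 + c ^ 2) := by
      rw [← Real.sqrt_sq_eq_abs]; exact Real.sqrt_lt_sqrt (sq_nonneg _) (by linarith)
    have habs' := abs_lt.1 habs
    refine ⟨√D * c / √(1 + c ^ 2), ⟨?_, ?_⟩, ?_⟩
    · rw [lt_div_iff₀ hcs]; nlinarith
    · rw [div_lt_iff₀ hcs]; nlinarith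
    · simp only [f]
      rw [hz2, Real.sqrt_div hD.le]
      field_simp
  have hinj : Set.InjOn f s := by
    intro y hy z hz hyz
    have h1 := hsq y hy
    have h2 := hsq z hz
    rw [hyz, h2] at h1
    have hy' := hlt y hy
    have hz' := hlt z hz
    have h3 : D - y ^ 2 = D - z ^ 2 := by
      rw [div_eq_div_iff hz'.ne' hy'.ne'] at h1
      exact mul_left_cancel₀ hD.ne' h1
    have h4 : 0 < √(D - z ^ 2) := Real.sqrt_pos.2 hz'
    simp only [f, h3] at hyz
    rwa [div_left_inj' h4.ne'] at hyz
  have hder : ∀ z ∈ s, HasDerivWithinAt f (D / √(D - z ^ 2) ^ 3) s z := fun z hz => by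
    have h := hlt z hz
    have h4 : 0 < √(D - z ^ 2) := Real.sqrt_pos.2 h
    have h5 : HasDerivAt (fun z : ℝ => √(D - z ^ 2)) (-(2 * z) / (2 * √(D - z ^ 2))) z := by
      have : HasDerivAt (fun z : ℝ => D - z ^ 2) (-(2 * z)) z := by
        simpa using (hasDerivAt_pow 2 z).const_sub D
      exact this.sqrt h.ne'
    convert! ((hasDerivAt_id z).div h5 h4.ne').hasDerivWithinAt using 1
    have h6 := Real.sq_sqrt h.le
    simp only [id]
    field_simp
    rw [h6]; ring
  -- For `|z| ≥ √D` the real square root is `0`, and `k ≠ 0` makes its power vanish, so the integral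
  -- over the line only sees the open interval.
  have hsupp : (Function.support fun z : ℝ =>
      ENNReal.ofReal (√(1 - z ^ 2 / D) ^ k) * H (z / √D) √(1 - z ^ 2 / D)) ⊆ s := by
    intro z hz
    by_contra hzs
    apply hz
    have : 1 - z ^ 2 / D ≤ 0 := by
      have : D ≤ z ^ 2 := by
        by_contra! h
        exact hzs (abs_lt.1 (Real.lt_sqrt_of_sq_lt (by simpa using h)))
      rw [sub_nonpos, le_div_iff₀ hD]; linarith
    simp [Real.sqrt_eq_zero_of_nonpos this, hk]
  rw [← setLIntegral_eq_of_support_subset hsupp,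
    ← lintegral_const_mul' _ _ ENNReal.ofReal_ne_top]
  conv_lhs => rw [← setLIntegral_univ, ← himg]
  rw [lintegral_image_eq_lintegral_abs_deriv_mul measurableSet_Ioo hder hinj]
  refine setLIntegral_congr_fun measurableSet_Ioo fun z hz => ?_
  have h4 : 0 < √(D - z ^ 2) := Real.sqrt_pos.2 (hlt z hz)
  rw [hq z hz, hr z hz, ← mul_assoc, ← mul_assoc, ← ENNReal.ofReal_mul (abs_nonneg _),
    ← ENNReal.ofReal_mul (by positivity)]
  congr 2
  · rw [abs_of_nonneg (by positivity)]
    have h6 := Real.sq_sqrt hD.le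
    rw [pow_add, div_pow (√(D - z ^ 2)) (√D) 3]
    field_simp
    exact h6.symm
  · simp only [f]; field_simp

/-- Integration over the sphere in tangent coordinates `u = (c e + v) / √(1 + c²)`, `v ⟂ e`. -/
theorem lintegral_toSphere_tangent {m : ℕ} (hm : m ≠ 0) {e : UnitSphere (m + 1)}
    {ι : EuclideanSpace ℝ (Fin m) →ₗᵢ[ℝ] EuclideanSpace ℝ (Fin (m + 1))}
    (hι : ∀ w, inner ℝ (e : EuclideanSpace ℝ (Fin (m + 1))) (ι w) = 0)
    (hmp : MeasurePreserving (fun p : ℝ × EuclideanSpace ℝ (Fin m) => p.1 • e.1 + ι p.2))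
    {G : EuclideanSpace ℝ (Fin (m + 1)) → ENNReal} (hG : Measurable G) :
    ∫⁻ u : UnitSphere (m + 1), G u ∂(volume : Measure (EuclideanSpace ℝ (Fin (m + 1)))).toSphere
      = ∫⁻ c : ℝ, ENNReal.ofReal ((√(1 + c ^ 2))⁻¹ ^ (m + 1)) *
        ∫⁻ v : UnitSphere m, G ((√(1 + c ^ 2))⁻¹ • (c • e.1 + ι v))
          ∂(volume : Measure (EuclideanSpace ℝ (Fin m))).toSphere := by
  have : Nonempty (Fin m) := ⟨⟨0, Nat.pos_of_ne_zero hm⟩⟩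
  have : Nontrivial (EuclideanSpace ℝ (Fin m)) := inferInstance
  have he : ‖e.1‖ = 1 := by simp
  -- Any radial weight with finite nonzero integral would do. Integrating `G (x / ‖x‖) h ‖x‖` in two
  -- ways produces the same factor `K` on both sides, and it cancels at the end.
  let h : ℝ → ENNReal := fun r => ENNReal.ofReal (Real.exp (-r))
  have hh : Measurable h := by fun_prop
  let K : ENNReal := ∫⁻ r in Set.Ioi (0 : ℝ), ENNReal.ofReal (r ^ m) * h r
  have hK : K = ENNReal.ofReal (Real.Gamma (m + 1)) := by
    have hpos : (0 : ℝ) < m + 1 := by positivity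
    rw [Real.Gamma_eq_integral hpos, ofReal_integral_eq_lintegral_ofReal
      (Real.GammaIntegral_convergent hpos)]
    · refine setLIntegral_congr_fun measurableSet_Ioi fun r hr => ?_
      have hr : 0 < r := hr
      simp only [h, add_sub_cancel_right, Real.rpow_natCast]
      rw [← ENNReal.ofReal_mul (by positivity), mul_comm]
    · filter_upwards [ae_restrict_mem measurableSet_Ioi] with r hr
      have hr : 0 < r := hr
      positivity
  have hK0 : K ≠ 0 := by
    rw [hK]; simpa using Real.Gamma_pos_of_pos (by positivity : (0 : ℝ) < m + 1)
  have hKt : K ≠ ⊤ := by rw [hK]; exact ENNReal.ofReal_ne_top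
  have hnorm : ∀ (c : ℝ) (v : UnitSphere m), ‖c • e.1 + ι v‖ = √(1 + c ^ 2) := by
    intro c v
    have h0 : inner ℝ (c • e.1) (ι v) = 0 := by rw [inner_smul_left, hι]; simp
    have := norm_add_sq_eq_norm_sq_add_norm_sq_of_inner_eq_zero _ _ h0
    rw [eq_comm, Real.sqrt_eq_iff_mul_self_eq (by positivity) (by positivity), this, ι.norm_map,
      norm_smul, he]
    simp [← sq]; ring
  have hιm : Measurable ι := ι.continuous.measurable
  let F : EuclideanSpace ℝ (Fin (m + 1)) → ENNReal := fun x => G (‖x‖⁻¹ • x) * h ‖x‖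
  have hF : Measurable F := by fun_prop
  have h1 : ∫⁻ x, F x = (∫⁻ u : UnitSphere (m + 1), G u
      ∂(volume : Measure (EuclideanSpace ℝ (Fin (m + 1)))).toSphere) * K := by
    have := lintegral_normalize (volume : Measure (EuclideanSpace ℝ (Fin (m + 1)))) hG hh
    rwa [finrank_euclideanSpace_fin, Nat.add_sub_cancel] at this
  have h2 : ∫⁻ x, F x = ∫⁻ w : EuclideanSpace ℝ (Fin m), ∫⁻ y : ℝ, F (y • e.1 + ι w) := by
    rw [← hmp.lintegral_comp hF, Measure.volume_eq_prod, lintegral_prod_symm']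
    fun_prop
  have h3 : ∫⁻ w : EuclideanSpace ℝ (Fin m), ∫⁻ y : ℝ, F (y • e.1 + ι w)
      = ∫⁻ v : UnitSphere m, (∫⁻ r in Set.Ioi (0 : ℝ), ENNReal.ofReal (r ^ (m - 1)) *
          ∫⁻ y : ℝ, F (y • e.1 + ι (r • v.1)))
          ∂(volume : Measure (EuclideanSpace ℝ (Fin m))).toSphere := by
    have := lintegral_polar (volume : Measure (EuclideanSpace ℝ (Fin m)))
      (G := fun w => ∫⁻ y : ℝ, F (y • e.1 + ι w)) (by
        refine Measurable.lintegral_prod_right' (f := fun p : EuclideanSpace ℝ (Fin m) × ℝ =>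
          F (p.2 • e.1 + ι p.1)) ?_
        fun_prop)
    rwa [finrank_euclideanSpace_fin] at this
  -- Put `y = r c`: the point becomes `r (c e + v)`, its direction no longer depends on `r`, and the
  -- Jacobian raises `r ^ (m - 1)` to `r ^ m`.
  have h4 : ∀ (v : UnitSphere m), ∀ r ∈ Set.Ioi (0 : ℝ), ENNReal.ofReal (r ^ (m - 1)) *
      (∫⁻ y : ℝ, F (y • e.1 + ι (r • v.1))) = ∫⁻ c : ℝ, ENNReal.ofReal (r ^ m) *
        (G ((√(1 + c ^ 2))⁻¹ • (c • e.1 + ι v)) * h (√(1 + c ^ 2) * r)) := by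
    intro v r hr
    have hr : 0 < r := hr
    have h5 := lintegral_comp_mul_left_real (fun y => F (y • e.1 + ι (r • v.1))) hr.ne'
    have h6 : (∫⁻ y : ℝ, F (y • e.1 + ι (r • v.1))) =
        ENNReal.ofReal r * ∫⁻ c : ℝ, F ((r * c) • e.1 + ι (r • v.1)) := by
      rw [h5, ← mul_assoc, ← ENNReal.ofReal_mul hr.le, abs_of_pos (by positivity),
        mul_inv_cancel₀ hr.ne', ENNReal.ofReal_one, one_mul]
    rw [h6, ← mul_assoc, ← ENNReal.ofReal_mul (by positivity), ← pow_succ,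
      Nat.sub_add_cancel (Nat.pos_of_ne_zero hm),
      ← lintegral_const_mul' _ _ ENNReal.ofReal_ne_top]
    refine lintegral_congr fun c => ?_
    have h7 : (r * c) • e.1 + ι (r • v.1) = r • (c • e.1 + ι v) := by
      rw [map_smul, smul_add, smul_smul]
    simp only [F, h7, norm_smul, hnorm, Real.norm_eq_abs, abs_of_pos hr, smul_smul]
    congr 2
    · rw [mul_inv, mul_right_comm, inv_mul_cancel₀ hr.ne', one_mul]
    · rw [mul_comm]
  have h8 : ∀ c : ℝ, ∫⁻ r in Set.Ioi (0 : ℝ), ENNReal.ofReal (r ^ m) * h (√(1 + c ^ 2) * r)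
      = ENNReal.ofReal ((√(1 + c ^ 2))⁻¹ ^ (m + 1)) * K := by
    intro c
    have hq : 0 < √(1 + c ^ 2) := by positivity
    set q := √(1 + c ^ 2)
    have h9 := lintegral_comp_mul_left_real
      ((Set.Ioi (0 : ℝ)).indicator fun r => ENNReal.ofReal (r ^ m) * h r) hq.ne'
    rw [lintegral_indicator measurableSet_Ioi, abs_of_pos (by positivity)] at h9
    rw [pow_succ, ENNReal.ofReal_mul (by positivity), mul_assoc]
    change _ = _ * (_ * ∫⁻ r in Set.Ioi (0 : ℝ), ENNReal.ofReal (r ^ m) * h r)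
    rw [← h9, ← lintegral_const_mul' _ _ ENNReal.ofReal_ne_top,
      ← lintegral_indicator measurableSet_Ioi]
    refine lintegral_congr fun r => ?_
    by_cases hr : 0 < r
    · have hr' : 0 < q * r := by positivity
      rw [Set.indicator_of_mem (by exact hr), Set.indicator_of_mem (by exact hr'), ← mul_assoc]
      congr 1
      rw [← ENNReal.ofReal_mul (by positivity), mul_pow, ← mul_assoc, ← mul_pow,
        inv_mul_cancel₀ hq.ne', one_pow, one_mul]
    · have hr' : ¬ 0 < q * r := fun h => hr (pos_of_mul_pos_right h hq.le)
      rw [Set.indicator_of_notMem (by exact hr), Set.indicator_of_notMem (by exact hr'), mul_zero]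
  have hKey : ∫⁻ x, F x = (∫⁻ c : ℝ, ENNReal.ofReal ((√(1 + c ^ 2))⁻¹ ^ (m + 1)) *
        ∫⁻ v : UnitSphere m, G ((√(1 + c ^ 2))⁻¹ • (c • e.1 + ι v))
          ∂(volume : Measure (EuclideanSpace ℝ (Fin m))).toSphere) * K := by
    rw [h2, h3]
    calc _ = ∫⁻ v : UnitSphere m, (∫⁻ c : ℝ, G ((√(1 + c ^ 2))⁻¹ • (c • e.1 + ι v)) *
          (ENNReal.ofReal ((√(1 + c ^ 2))⁻¹ ^ (m + 1)) * K))
          ∂(volume : Measure (EuclideanSpace ℝ (Fin m))).toSphere := by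
          refine lintegral_congr fun v => ?_
          rw [setLIntegral_congr_fun measurableSet_Ioi (h4 v), lintegral_lintegral_swap]
          · refine lintegral_congr fun c => ?_
            rw [← h8 c, ← lintegral_const_mul _ (by fun_prop)]
            refine lintegral_congr fun r => ?_
            ring
          · refine Measurable.aemeasurable ?_
            fun_prop
      _ = _ := by
          rw [lintegral_lintegral_swap (by fun_prop), ← lintegral_mul_const]
          · refine lintegral_congr fun c => ?_
            rw [lintegral_mul_const _ (by fun_prop)]
            ring
          · refine Measurable.mul (by fun_prop) ?_
            refine Measurable.lintegral_prod_right' (f := fun p : ℝ × UnitSphere m =>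
              G ((√(1 + p.1 ^ 2))⁻¹ • (p.1 • e.1 + ι p.2))) ?_
            fun_prop
  rw [h1] at hKey
  exact (ENNReal.mul_left_inj hK0 hKt).1 hKey

/-! ### The density of one height and its Gaussian limit -/

/-- The density, up to a constant, of `√d ⟨e, U⟩` for `U` uniform on `S^{d-1}`. -/
noncomputable def sliceWeight (d : ℕ) (z : ℝ) : ℝ := √(1 - z ^ 2 / d) ^ (d - 3)

/-- The density of `√d ⟨e, U⟩` for `U` uniform on `S^{d-1}`, `d ≥ 4`. -/
noncomputable def sliceDensity (d : ℕ) (z : ℝ) : ℝ := sliceWeight d z / ∫ y, sliceWeight d y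

theorem sliceWeight_nonneg (d : ℕ) (z : ℝ) : 0 ≤ sliceWeight d z := by
  unfold sliceWeight; positivity

theorem sliceDensity_nonneg (d : ℕ) (z : ℝ) : 0 ≤ sliceDensity d z :=
  div_nonneg (sliceWeight_nonneg d z) (integral_nonneg (sliceWeight_nonneg d))

theorem continuous_sliceWeight (d : ℕ) : Continuous (sliceWeight d) := by
  unfold sliceWeight; fun_prop

theorem continuous_sliceDensity (d : ℕ) : Continuous (sliceDensity d) :=
  (continuous_sliceWeight d).div_const _

theorem sliceWeight_le_one (d : ℕ) (z : ℝ) : sliceWeight d z ≤ 1 := by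
  unfold sliceWeight
  refine pow_le_one₀ (Real.sqrt_nonneg _) (Real.sqrt_le_one.2 ?_)
  have : 0 ≤ z ^ 2 / d := by positivity
  linarith

/-- From `1 - w ≤ exp (-w)`, the exponent is at least `(d - 3) / (2 d) ≥ 1 / 8` times `z²` once `d ≥
4`. This dominates the weights uniformly in `d`. -/
theorem sliceWeight_le_exp {d : ℕ} (hd : 4 ≤ d) (z : ℝ) :
    sliceWeight d z ≤ Real.exp (-(1 / 8) * z ^ 2) := by
  have hd' : (4 : ℝ) ≤ d := by exact_mod_cast hd
  have h1 : √(1 - z ^ 2 / d) ≤ Real.exp (-(z ^ 2 / d) / 2) := by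
    rw [Real.exp_half]
    apply Real.sqrt_le_sqrt
    have := Real.add_one_le_exp (-(z ^ 2 / d))
    linarith
  calc sliceWeight d z ≤ Real.exp (-(z ^ 2 / d) / 2) ^ (d - 3) := by
        unfold sliceWeight; gcongr
    _ = Real.exp (((d : ℝ) - 3) * (-(z ^ 2 / d) / 2)) := by
        rw [← Real.exp_nat_mul, Nat.cast_sub (by omega)]; simp
    _ ≤ _ := by
        apply Real.exp_le_exp.2
        have h2 : (1 / 4 : ℝ) ≤ (d - 3) / d := by
          rw [div_le_div_iff₀ (by norm_num) (by linarith)]; linarith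
        have h3 : ((d : ℝ) - 3) * (-(z ^ 2 / d) / 2) = -((d - 3) / d) * z ^ 2 / 2 := by
          field_simp
        rw [h3]
        nlinarith [sq_nonneg z]

theorem integrable_sliceWeight {d : ℕ} (hd : 4 ≤ d) : Integrable (sliceWeight d) := by
  refine (integrable_exp_neg_mul_sq (b := 1 / 8) (by norm_num)).mono'
    (continuous_sliceWeight d).aestronglyMeasurable (ae_of_all _ fun z => ?_)
  rw [Real.norm_of_nonneg (sliceWeight_nonneg d z)]
  exact sliceWeight_le_exp hd z

/-- `√(1 - z²/d)^(d-3) → exp (-z²/2)`, locally uniformly. -/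
theorem tendsto_sliceWeight (a : ℝ) :
    Tendsto (fun p : ℕ × ℝ => sliceWeight p.1 p.2) (atTop ×ˢ nhds a)
      (nhds (Real.exp (-a ^ 2 / 2))) := by
  have hd : Tendsto (fun p : ℕ × ℝ => (p.1 : ℝ)) (atTop ×ˢ nhds a) atTop :=
    tendsto_natCast_atTop_atTop.comp tendsto_fst
  have hz : Tendsto (fun p : ℕ × ℝ => p.2 ^ 2) (atTop ×ˢ nhds a) (nhds (a ^ 2)) :=
    tendsto_snd.pow 2
  have hzd : Tendsto (fun p : ℕ × ℝ => p.2 ^ 2 / p.1) (atTop ×ˢ nhds a) (nhds 0) :=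
    hz.div_atTop hd
  -- The bounds `1 - 1 / w ≤ log w ≤ w - 1` squeeze the product between `-z² / (1 - z² / d)` and
  -- `-z²`.
  have hlog : Tendsto (fun p : ℕ × ℝ => (p.1 : ℝ) * Real.log (1 - p.2 ^ 2 / p.1))
      (atTop ×ˢ nhds a) (nhds (-a ^ 2)) := by
    have h1 : Tendsto (fun p : ℕ × ℝ => -p.2 ^ 2 / (1 - p.2 ^ 2 / p.1)) (atTop ×ˢ nhds a)
        (nhds (-a ^ 2)) := by
      have := (hz.neg).div (tendsto_const_nhds.sub hzd : Tendsto (fun p : ℕ × ℝ =>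
        (1 : ℝ) - p.2 ^ 2 / p.1) _ _) (by norm_num)
      rw [sub_zero, div_one] at this
      exact this
    refine tendsto_of_tendsto_of_tendsto_of_le_of_le' h1 hz.neg ?_ ?_
    · filter_upwards [hzd.eventually_lt_const (by norm_num : (0 : ℝ) < 1),
        hd.eventually_gt_atTop 0] with p h2 h3
      have h4 : 0 < 1 - p.2 ^ 2 / p.1 := by linarith
      have h5 := Real.one_sub_inv_le_log_of_pos h4
      calc -p.2 ^ 2 / (1 - p.2 ^ 2 / p.1) = p.1 * (1 - (1 - p.2 ^ 2 / p.1)⁻¹) := by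
            have h6 := h4.ne'
            have h7 : p.2 ^ 2 = p.2 ^ 2 / p.1 * p.1 := by field_simp
            generalize p.2 ^ 2 / (p.1 : ℝ) = w at *
            rw [h7]
            field_simp; ring
        _ ≤ _ := by gcongr
    · filter_upwards [hzd.eventually_lt_const (by norm_num : (0 : ℝ) < 1),
        hd.eventually_gt_atTop 0] with p h2 h3
      have h4 : 0 < 1 - p.2 ^ 2 / p.1 := by linarith
      have h5 := Real.log_le_sub_one_of_pos h4
      calc (p.1 : ℝ) * Real.log (1 - p.2 ^ 2 / p.1) ≤ p.1 * (1 - p.2 ^ 2 / p.1 - 1) := by gcongr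
        _ = -p.2 ^ 2 := by field_simp; ring
  have hratio : Tendsto (fun p : ℕ × ℝ => ((p.1 : ℝ) - 3) / p.1) (atTop ×ˢ nhds a) (nhds 1) := by
    have h6 : Tendsto (fun p : ℕ × ℝ => 1 - 3 / (p.1 : ℝ)) (atTop ×ˢ nhds a) (nhds (1 - 0)) :=
      tendsto_const_nhds.sub (tendsto_const_nhds.div_atTop hd)
    rw [sub_zero] at h6
    refine h6.congr' ?_
    filter_upwards [hd.eventually_gt_atTop 0] with p h3
    field_simp
  have hexp := Real.continuous_exp.continuousAt.tendsto.comp ((hratio.mul hlog).div_const 2)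
  rw [one_mul] at hexp
  refine hexp.congr' ?_
  filter_upwards [hzd.eventually_lt_const (by norm_num : (0 : ℝ) < 1),
    hd.eventually_ge_atTop 4] with p h2 h3
  have h4 : 0 < 1 - p.2 ^ 2 / p.1 := by linarith
  have h3' : 4 ≤ p.1 := by exact_mod_cast h3
  have h7 : √(1 - p.2 ^ 2 / p.1) = Real.exp (Real.log (1 - p.2 ^ 2 / p.1) / 2) := by
    rw [Real.exp_half, Real.exp_log h4]
  simp only [Function.comp, sliceWeight]
  rw [h7, ← Real.exp_nat_mul, Nat.cast_sub (by omega)]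
  congr 1
  push_cast
  field_simp

theorem tendsto_integral_sliceWeight :
    Tendsto (fun d : ℕ => ∫ z, sliceWeight d z) atTop (nhds √(2 * Real.pi)) := by
  have h : ∫ z : ℝ, Real.exp (-z ^ 2 / 2) = √(2 * Real.pi) := by
    have := integral_gaussian (1 / 2)
    rw [show Real.pi / (1 / 2) = 2 * Real.pi by ring] at this
    rw [← this]; congr 1; ext z; congr 1; ring
  rw [← h]
  refine tendsto_integral_filter_of_dominated_convergence
    (fun z => Real.exp (-(1 / 8) * z ^ 2)) ?_ ?_ (integrable_exp_neg_mul_sq (by norm_num)) ?_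
  · exact .of_forall fun d => (continuous_sliceWeight d).aestronglyMeasurable
  · filter_upwards [eventually_ge_atTop 4] with d hd
    refine ae_of_all _ fun z => ?_
    rw [Real.norm_of_nonneg (sliceWeight_nonneg d z)]
    exact sliceWeight_le_exp hd z
  · refine ae_of_all _ fun z => ?_
    have hz : Tendsto (fun d : ℕ => (d, z)) atTop (atTop ×ˢ nhds z) :=
      tendsto_id.prodMk tendsto_const_nhds
    have h1 := Tendsto.comp (tendsto_sliceWeight z) hz

    exact h1

theorem tendsto_sliceDensity (a : ℝ) :
    Tendsto (fun p : ℕ × ℝ => sliceDensity p.1 p.2) (atTop ×ˢ nhds a)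
      (nhds (gaussianPDFReal 0 1 a)) := by
  have := (tendsto_sliceWeight a).div (tendsto_integral_sliceWeight.comp tendsto_fst)
    (by positivity)
  convert! this using 2
  rw [gaussianPDFReal]
  simp [div_eq_inv_mul]

/-- The weight is at most `1` and its integral tends to `√(2π) > 1`. A bound for all `z` is needed
where the argument of the density is not close to `a`, as happens for correlated points. -/
theorem eventually_sliceDensity_le_one : ∀ᶠ d : ℕ in atTop, ∀ z, sliceDensity d z ≤ 1 := by
  have h : (1 : ℝ) < √(2 * Real.pi) := by
    rw [Real.lt_sqrt (by norm_num)]; nlinarith [Real.pi_gt_three]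
  filter_upwards [tendsto_integral_sliceWeight.eventually_const_lt h] with d hd z
  rw [sliceDensity, div_le_one (by linarith)]
  exact (sliceWeight_le_one d z).trans hd.le

/-! ### Slices of the uniform measure and conditional laws of heights -/

/-- The slices of the sphere orthogonal to `e`. -/
theorem exists_lintegral_uniformSphere_slice {m : ℕ} (hm : 3 ≤ m) (e : UnitSphere (m + 1)) :
    ∃ ι : EuclideanSpace ℝ (Fin m) →ₗᵢ[ℝ] EuclideanSpace ℝ (Fin (m + 1)),
      (∀ w, inner ℝ (e : EuclideanSpace ℝ (Fin (m + 1))) (ι w) = 0) ∧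
      (∀ x, ∃ w, x = inner ℝ (e : EuclideanSpace ℝ (Fin (m + 1))) x • e.1 + ι w) ∧
      ∀ G : EuclideanSpace ℝ (Fin (m + 1)) → ENNReal, Measurable G →
        ∫⁻ u, G u ∂uniformSphere (m + 1) = ∫⁻ z : ℝ, ENNReal.ofReal (sliceDensity (m + 1) z) *
          ∫⁻ v, G ((z / √(m + 1 : ℕ)) • e.1 + √(1 - z ^ 2 / (m + 1 : ℕ)) • ι v)
            ∂uniformSphere m := by
  obtain ⟨ι, h1, h2, h3⟩ := exists_orthogonal_slice e
  refine ⟨ι, h1, h2, ?_⟩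
  have : NeZero m := ⟨by omega⟩
  have hD : (0 : ℝ) < (m + 1 : ℕ) := by positivity
  have hpos : 0 < ∫ y, sliceWeight (m + 1) y := by
    rw [integral_pos_iff_support_of_nonneg (sliceWeight_nonneg _)
      (integrable_sliceWeight (by omega))]
    refine (continuous_sliceWeight _).isOpen_support.measure_pos _ ⟨0, ?_⟩
    simp [sliceWeight]
  have hA : ∫⁻ z, ENNReal.ofReal (sliceWeight (m + 1) z)
      = ENNReal.ofReal (∫ y, sliceWeight (m + 1) y) :=
    (ofReal_integral_eq_lintegral_ofReal (integrable_sliceWeight (by omega))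
      (ae_of_all _ (sliceWeight_nonneg _))).symm
  have : Nonempty (Fin m) := ⟨⟨0, by omega⟩⟩
  have : Nontrivial (EuclideanSpace ℝ (Fin m)) := inferInstance
  let c := (volume : Measure (EuclideanSpace ℝ (Fin m))).toSphere Set.univ
  have hc0 : c ≠ 0 := by
    exact fun h => (volume : Measure (EuclideanSpace ℝ (Fin m))).toSphere_ne_zero
      (Measure.measure_univ_eq_zero.1 h)
  have hct : c ≠ ⊤ := measure_ne_top _ _
  have hu : (volume : Measure (EuclideanSpace ℝ (Fin m))).toSphere = c • uniformSphere m := by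
    rw [uniformSphere, smul_smul, ENNReal.mul_inv_cancel hc0 hct, one_smul]
  -- Only proportionality matters here: the value of `κ` is read off afterwards by testing on `G =
  -- 1`.
  obtain ⟨κ, hκ⟩ : ∃ κ : ENNReal, ∀ G : EuclideanSpace ℝ (Fin (m + 1)) → ENNReal, Measurable G →
        ∫⁻ u, G u ∂uniformSphere (m + 1) = κ * ∫⁻ z : ℝ, ENNReal.ofReal (sliceWeight (m + 1) z) *
          ∫⁻ v, G ((z / √(m + 1 : ℕ)) • e.1 + √(1 - z ^ 2 / (m + 1 : ℕ)) • ι v)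
            ∂uniformSphere m := by
    refine ⟨((volume : Measure (EuclideanSpace ℝ (Fin (m + 1)))).toSphere Set.univ)⁻¹ *
      (ENNReal.ofReal (√(m + 1 : ℕ))⁻¹ * c), fun G hG => ?_⟩
    rw [uniformSphere, lintegral_smul_measure, lintegral_toSphere_tangent (by omega) h1 h3 hG]
    have hk : m + 1 - 3 + 3 = m + 1 := by omega
    have := lintegral_tangent_subst hD (k := m + 1 - 3) (by omega) fun y q =>
      ∫⁻ v : UnitSphere m, G (y • e.1 + q • ι v)
        ∂(volume : Measure (EuclideanSpace ℝ (Fin m))).toSphere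
    rw [hk] at this
    rw [smul_eq_mul, mul_assoc, mul_assoc]
    congr 1
    have h4 : ∀ (x : ℝ) (v : UnitSphere m), (√(1 + x ^ 2))⁻¹ • (x • e.1 + ι v)
        = (x * (√(1 + x ^ 2))⁻¹) • e.1 + (√(1 + x ^ 2))⁻¹ • ι v := fun x v => by
      rw [smul_add, smul_smul, mul_comm]
    simp only [h4]
    rw [this]
    congr 1
    rw [← lintegral_const_mul' _ _ hct]
    refine lintegral_congr fun z => ?_
    rw [hu, lintegral_smul_measure, smul_eq_mul, sliceWeight]
    ring
  have hκ1 : κ * ENNReal.ofReal (∫ y, sliceWeight (m + 1) y) = 1 := by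
    have := hκ (fun _ => 1) measurable_const
    simp only [lintegral_const, measure_univ, mul_one] at this
    rw [this, hA]
  have hκ2 : κ = ENNReal.ofReal (∫ y, sliceWeight (m + 1) y)⁻¹ := by
    rw [ENNReal.ofReal_inv_of_pos hpos]
    exact ENNReal.eq_inv_of_mul_eq_one_left hκ1
  intro G hG
  rw [hκ G hG, hκ2, ← lintegral_const_mul' _ _ ENNReal.ofReal_ne_top]
  refine lintegral_congr fun z => ?_
  rw [← mul_assoc, ← ENNReal.ofReal_mul (by positivity), sliceDensity,
    div_eq_inv_mul (sliceWeight _ _)]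

/-- The height `√d ⟨x, u⟩` of a point `u` of the slice `√d ⟨e, u⟩ = z` of `S^{d-1}`, `d = m + 1`,
where `⟨x, e⟩ = ρ` and `q` is the inner product of the directions of `x` and `u` in `e^⟂`. -/
noncomputable def sliceHeight (m : ℕ) (ρ z q : ℝ) : ℝ :=
  ρ * z + √(1 - z ^ 2 / (m + 1 : ℕ)) * (√(1 - ρ ^ 2) * (√(m + 1 : ℕ) * q))

theorem continuous_sphereInner {d : ℕ} (x : UnitSphere d) : Continuous (sphereInner x) := by
  unfold sphereInner; fun_prop

@[fun_prop]
theorem measurable_sphereInner {d : ℕ} (x : UnitSphere d) : Measurable (sphereInner x) :=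
  (continuous_sphereInner x).measurable

theorem sphereInner_comm {d : ℕ} (x y : UnitSphere d) : sphereInner x y = sphereInner y x :=
  real_inner_comm _ _

/-- The joint law of the heights `√d ⟨y, U⟩`, sliced along `√d ⟨e, U⟩ = z`. -/
theorem exists_slice_projection {m : ℕ} (hm : 3 ≤ m) (e : UnitSphere (m + 1)) :
    ∃ π : UnitSphere (m + 1) → UnitSphere m, ∀ (κ : Type) [Countable κ]
      (y : κ → UnitSphere (m + 1)) (G : ℝ × (κ → ℝ) → ENNReal), Measurable G →
      ∫⁻ u, G (√(m + 1 : ℕ) * sphereInner e u, fun i => √(m + 1 : ℕ) * sphereInner (y i) u)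
          ∂uniformSphere (m + 1)
        = ∫⁻ z : ℝ, ENNReal.ofReal (sliceDensity (m + 1) z) *
          ∫⁻ v, G (z, fun i => sliceHeight m (sphereInner (y i) e) z (sphereInner (π (y i)) v))
            ∂uniformSphere m := by
  obtain ⟨ι, h1, h2, h3⟩ := exists_lintegral_uniformSphere_slice hm e
  have he : ‖e.1‖ = 1 := by simp
  have hD : 0 < √(m + 1 : ℕ) := by positivity
  have hπ : ∀ x : UnitSphere (m + 1), ∃ x' : UnitSphere m, ∀ v : UnitSphere m,
      inner ℝ x.1 (ι v) = √(1 - sphereInner x e ^ 2) * sphereInner x' v := by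
    intro x
    obtain ⟨w, hw⟩ := h2 x
    have hx : ‖x.1‖ = 1 := by simp
    have hin : ∀ v, inner ℝ x.1 (ι v) = inner ℝ w v := fun v => by
      conv_lhs => rw [hw]
      rw [inner_add_left, inner_smul_left, h1, ι.inner_map_map]; simp
    have hnorm : ‖w‖ ^ 2 = 1 - sphereInner x e ^ 2 := by
      have h0 : inner ℝ (inner ℝ e.1 x.1 • e.1) (ι w) = 0 := by
        rw [inner_smul_left, h1]; simp
      have h5 := norm_add_sq_eq_norm_sq_add_norm_sq_of_inner_eq_zero _ _ h0
      rw [← hw, hx, norm_smul, he, ι.norm_map, Real.norm_eq_abs] at h5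
      have h6 := abs_mul_abs_self (inner ℝ e.1 x.1)
      rw [sphereInner, real_inner_comm]
      nlinarith
    rw [← hnorm, Real.sqrt_sq (norm_nonneg w)]
    -- Here `x = ±e` has no direction in `e^⟂`. The factor `√(1 - ρ²)` is then `0`, so any point can
    -- serve as its projection.
    by_cases hw0 : w = 0
    · have : Nonempty (Fin m) := ⟨⟨0, by omega⟩⟩
      have : Nontrivial (EuclideanSpace ℝ (Fin m)) := inferInstance
      obtain ⟨x', hx'⟩ := NormedSpace.sphere_nonempty (E := EuclideanSpace ℝ (Fin m)) (x := 0)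
        (r := 1) |>.2 zero_le_one
      exact ⟨⟨x', hx'⟩, fun v => by rw [hin]; simp [hw0]⟩
    · have hw' : ‖w‖ ≠ 0 := norm_ne_zero_iff.2 hw0
      refine ⟨⟨‖w‖⁻¹ • w, by simp [norm_smul, hw0]⟩, fun v => ?_⟩
      rw [hin, sphereInner, inner_smul_left]
      simp [hw0]
  choose π hπ using hπ
  refine ⟨π, fun κ _ y G hG => ?_⟩
  have := h3 (fun u => G (√(m + 1 : ℕ) * inner ℝ e.1 u,
    fun i => √(m + 1 : ℕ) * inner ℝ (y i).1 u)) (hG.comp (by fun_prop))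
  refine this.trans (lintegral_congr fun z => ?_)
  congr 1
  refine lintegral_congr fun v => ?_
  congr 2
  · rw [inner_add_right, inner_smul_right, inner_smul_right, h1]
    simp only [real_inner_self_eq_norm_sq, he]
    field_simp; ring
  · funext i
    rw [inner_add_right, inner_smul_right, inner_smul_right, hπ, sliceHeight]
    change _ * (z / _ * sphereInner (y i) e + _) = _
    field_simp

theorem lintegral_height {m : ℕ} (hm : 3 ≤ m) (e : UnitSphere (m + 1)) {G : ℝ → ENNReal}
    (hG : Measurable G) :
    ∫⁻ u, G (√(m + 1 : ℕ) * sphereInner e u) ∂uniformSphere (m + 1)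
      = ∫⁻ z, ENNReal.ofReal (sliceDensity (m + 1) z) * G z := by
  have : NeZero m := ⟨by omega⟩
  obtain ⟨π, h⟩ := exists_slice_projection hm e
  have := h Empty Empty.elim (fun p => G p.1) (by fun_prop)
  simpa using this

theorem uniformSphere_height_mem {m : ℕ} (hm : 3 ≤ m) (e : UnitSphere (m + 1)) {B : Set ℝ}
    (hB : MeasurableSet B) :
    uniformSphere (m + 1) {u | √(m + 1 : ℕ) * sphereInner e u ∈ B}
      = ∫⁻ z in B, ENNReal.ofReal (sliceDensity (m + 1) z) := by
  have h := lintegral_height hm e (G := B.indicator 1) (measurable_one.indicator hB)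
  rw [← lintegral_indicator hB]
  have hm : Measurable fun u : UnitSphere (m + 1) => √(m + 1 : ℕ) * sphereInner e u := by fun_prop
  refine (lintegral_indicator_one (hm hB)).symm.trans (h.trans (lintegral_congr fun z => ?_))
  by_cases hz : z ∈ B <;> simp [hz]

/-- The factor by which a slice scales the heights. -/
noncomputable def sliceScale (m : ℕ) (ρ z : ℝ) : ℝ :=
  √(1 - z ^ 2 / (m + 1 : ℕ)) * √(1 - ρ ^ 2) * (√(m + 1 : ℕ) / √m)

/-- The density of the height `√d ⟨x, U⟩` conditionally on `√d ⟨e, U⟩ = z`, where `⟨x, e⟩ = ρ`. -/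
noncomputable def condDensity (m : ℕ) (ρ z y : ℝ) : ℝ :=
  sliceDensity m ((y - ρ * z) / sliceScale m ρ z) / sliceScale m ρ z

/-- On a fixed slice the height is the affine image `ρ z + s (√m ⟨x, v⟩)` of a height on the smaller
sphere, with `s` the slice scale, so its density is `condDensity`. The one-point law is applied on
that smaller sphere, which requires `4 ≤ m`. -/
theorem uniformSphere_sliceHeight_le {m : ℕ} (hm : 4 ≤ m) (x : UnitSphere m) {ρ z N : ℝ}
    {B : Set ℝ} (hB : MeasurableSet B) (hs : 0 < sliceScale m ρ z)
    (hN : ∀ y ∈ B, condDensity m ρ z y ≤ N) :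
    uniformSphere m {v | sliceHeight m ρ z (sphereInner x v) ∈ B}
      ≤ ENNReal.ofReal N * volume B := by
  obtain ⟨m, rfl⟩ : ∃ k, m = k + 1 := ⟨m - 1, by omega⟩
  set s := sliceScale (m + 1) ρ z with hsdef
  have hsm : 0 < √(m + 1 : ℕ) := by positivity
  have hset : {v : UnitSphere (m + 1) | sliceHeight (m + 1) ρ z (sphereInner x v) ∈ B}
      = {v | √(m + 1 : ℕ) * sphereInner x v ∈ {w | ρ * z + s * w ∈ B}} := by
    ext v
    have : sliceHeight (m + 1) ρ z (sphereInner x v)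
        = ρ * z + s * (√(m + 1 : ℕ) * sphereInner x v) := by
      rw [sliceHeight, hsdef, sliceScale]; field_simp
    simp only [Set.mem_ofPred_eq, this]
  have hB' : MeasurableSet {w | ρ * z + s * w ∈ B} :=
    (by fun_prop : Measurable fun w : ℝ => ρ * z + s * w) hB
  rw [hset, uniformSphere_height_mem (by omega) x hB', ← lintegral_indicator hB']
  have h1 := lintegral_comp_mul_left_real (fun y => B.indicator
    (fun y => ENNReal.ofReal (condDensity (m + 1) ρ z y * s)) (ρ * z + y)) hs.ne'
  have h2 := lintegral_add_left_eq_self (μ := volume) (B.indicator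
    (fun y => ENNReal.ofReal (condDensity (m + 1) ρ z y * s))) (ρ * z)
  rw [h2, lintegral_indicator hB] at h1
  calc _ = ∫⁻ w, B.indicator (fun y => ENNReal.ofReal (condDensity (m + 1) ρ z y * s))
        (ρ * z + s * w) := by
        refine lintegral_congr fun w => ?_
        by_cases hw : ρ * z + s * w ∈ B
        · rw [Set.indicator_of_mem (by exact hw), Set.indicator_of_mem hw, condDensity, ← hsdef,
            div_mul_cancel₀ _ hs.ne', add_sub_cancel_left, mul_div_cancel_left₀ _ hs.ne']
        · rw [Set.indicator_of_notMem (by exact hw), Set.indicator_of_notMem hw]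
    _ = ENNReal.ofReal |s⁻¹| * ∫⁻ y in B, ENNReal.ofReal (condDensity (m + 1) ρ z y * s) := h1
    _ ≤ ENNReal.ofReal |s⁻¹| * ∫⁻ y in B, ENNReal.ofReal (N * s) := by
        refine mul_le_mul' le_rfl (setLIntegral_mono measurable_const fun y hy =>
          ENNReal.ofReal_le_ofReal (mul_le_mul_of_nonneg_right (hN y hy) hs.le))
    _ = _ := by
        rw [setLIntegral_const, ← mul_assoc, ← ENNReal.ofReal_mul (abs_nonneg _),
          abs_of_pos (by positivity)]
        congr 2
        field_simp

theorem uniformSphere_height_le {m : ℕ} (hm : 3 ≤ m) (e : UnitSphere (m + 1)) {B : Set ℝ}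
    (hB : MeasurableSet B) {M : ℝ} (hM : ∀ z ∈ B, sliceDensity (m + 1) z ≤ M) :
    uniformSphere (m + 1) {u | √(m + 1 : ℕ) * sphereInner e u ∈ B}
      ≤ ENNReal.ofReal M * volume B := by
  rw [uniformSphere_height_mem hm e hB, ← setLIntegral_const]
  exact setLIntegral_mono measurable_const fun z hz => ENNReal.ofReal_le_ofReal (hM z hz)

theorem le_uniformSphere_height {m : ℕ} (hm : 3 ≤ m) (e : UnitSphere (m + 1)) {B : Set ℝ}
    (hB : MeasurableSet B) {M : ℝ} (hM : ∀ z ∈ B, M ≤ sliceDensity (m + 1) z) :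
    ENNReal.ofReal M * volume B ≤
      uniformSphere (m + 1) {u | √(m + 1 : ℕ) * sphereInner e u ∈ B} := by
  rw [uniformSphere_height_mem hm e hB, ← setLIntegral_const]
  exact setLIntegral_mono ((continuous_sliceDensity _).measurable.ennreal_ofReal)
    fun z hz => ENNReal.ofReal_le_ofReal (hM z hz)

/-- Bound the density of the first height by `M` and the conditional density of the second by `N`.
Leaving both free serves two regimes: constants near `φ(a)` for almost orthogonal points, and `1`
and `2 / √(1 - |ρ|)` in general. -/
theorem uniformSphere_pair_le {m : ℕ} (hm : 4 ≤ m) (x y : UnitSphere (m + 1)) {B C : Set ℝ}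
    (hB : MeasurableSet B) (hC : MeasurableSet C) {M N : ℝ} (hM0 : 0 ≤ M)
    (hM : ∀ z ∈ B, sliceDensity (m + 1) z ≤ M)
    (hs : ∀ z ∈ B, 0 < sliceScale m (sphereInner x y) z)
    (hN : ∀ z ∈ B, ∀ w ∈ C, condDensity m (sphereInner x y) z w ≤ N) :
    uniformSphere (m + 1) {u | √(m + 1 : ℕ) * sphereInner x u ∈ B ∧
        √(m + 1 : ℕ) * sphereInner y u ∈ C}
      ≤ ENNReal.ofReal (M * N) * (volume B * volume C) := by
  obtain ⟨π, h⟩ := exists_slice_projection (by omega : 3 ≤ m) x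
  let A : Set (ℝ × (Unit → ℝ)) := {p | p.1 ∈ B ∧ p.2 () ∈ C}
  have hA : MeasurableSet A := (measurable_fst hB).inter
    ((by fun_prop : Measurable fun p : ℝ × (Unit → ℝ) => p.2 ()) hC)
  have h1 := h Unit (fun _ => y) (A.indicator 1) (measurable_one.indicator hA)
  have hm1 : Measurable fun u : UnitSphere (m + 1) =>
      (√(m + 1 : ℕ) * sphereInner x u, fun _ : Unit => √(m + 1 : ℕ) * sphereInner y u) := by
    fun_prop
  calc _ = ∫⁻ u, A.indicator (1 : ℝ × (Unit → ℝ) → ENNReal) (√(m + 1 : ℕ) * sphereInner x u,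
          fun _ : Unit => √(m + 1 : ℕ) * sphereInner y u) ∂uniformSphere (m + 1) :=
        (lintegral_indicator_one (hm1 hA)).symm
    _ ≤ ∫⁻ z in B, ENNReal.ofReal (M * N) * volume C := by
        rw [h1, ← lintegral_indicator hB]
        refine lintegral_mono fun z => ?_
        by_cases hz : z ∈ B
        · rw [Set.indicator_of_mem hz, ENNReal.ofReal_mul hM0, mul_assoc]
          refine mul_le_mul' (ENNReal.ofReal_le_ofReal (hM z hz)) ?_
          have hm2 : Measurable fun v : UnitSphere m =>
            sliceHeight m (sphereInner y x) z (sphereInner (π y) v) := by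
            unfold sliceHeight; fun_prop
          have h2 := uniformSphere_sliceHeight_le hm (π y) hC (hs z hz) (hN z hz)
          rw [sphereInner_comm x y] at h2
          refine le_trans (le_of_eq ?_) h2
          refine Eq.trans (lintegral_congr fun v => ?_) (lintegral_indicator_one (hm2 hC))
          by_cases hv : sliceHeight m (sphereInner y x) z (sphereInner (π y) v) ∈ C
          · rw [Set.indicator_of_mem (by exact ⟨hz, hv⟩), Set.indicator_of_mem (by exact hv)]
            rfl
          · rw [Set.indicator_of_notMem (fun h => hv h.2), Set.indicator_of_notMem (by exact hv)]
        · have : ∀ w, A.indicator (1 : ℝ × (Unit → ℝ) → ENNReal) (z, w) = 0 := fun w =>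
            Set.indicator_of_notMem (fun h => hz h.1) _
          simp [this]
    _ = _ := by rw [setLIntegral_const]; ring

/-! ### Uniform limits of the densities near the height `a` -/

theorem exists_forall_sliceDensity_near (a : ℝ) {η : ℝ} (hη : 0 < η) :
    ∃ δ > 0, ∀ᶠ d : ℕ in atTop, ∀ z, |z - a| < δ →
      |sliceDensity d z - gaussianPDFReal 0 1 a| < η := by
  have h := (tendsto_sliceDensity a).eventually (Metric.ball_mem_nhds _ hη)
  obtain ⟨A, hA, B, hB, h⟩ := eventually_prod_iff.1 h
  obtain ⟨δ, hδ, hB⟩ := Metric.eventually_nhds_iff.1 hB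
  refine ⟨δ, hδ, hA.mono fun d hd z hz => ?_⟩
  exact h hd (hB (by rwa [Real.dist_eq]))

theorem tendsto_sliceScale (a : ℝ) :
    Tendsto (fun p : ℕ × (ℝ × ℝ) => sliceScale p.1 p.2.1 p.2.2) (atTop ×ˢ nhds (0, a))
      (nhds 1) := by
  have hm : Tendsto (fun p : ℕ × (ℝ × ℝ) => ((p.1 + 1 : ℕ) : ℝ)) (atTop ×ˢ nhds (0, a)) atTop :=
    tendsto_natCast_atTop_atTop.comp ((tendsto_add_atTop_nat 1).comp tendsto_fst)
  have hm0 : Tendsto (fun p : ℕ × (ℝ × ℝ) => (p.1 : ℝ)) (atTop ×ˢ nhds (0, a)) atTop :=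
    tendsto_natCast_atTop_atTop.comp tendsto_fst
  have hρ : Tendsto (fun p : ℕ × (ℝ × ℝ) => p.2.1) (atTop ×ˢ nhds (0, a)) (nhds 0) :=
    (continuous_fst.tendsto ((0 : ℝ), a)).comp tendsto_snd
  have hz : Tendsto (fun p : ℕ × (ℝ × ℝ) => p.2.2) (atTop ×ˢ nhds (0, a)) (nhds a) :=
    (continuous_snd.tendsto ((0 : ℝ), a)).comp tendsto_snd
  have h1 : Tendsto (fun p : ℕ × (ℝ × ℝ) => √(1 - p.2.2 ^ 2 / (p.1 + 1 : ℕ)))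
      (atTop ×ˢ nhds (0, a)) (nhds 1) := by
    have := (tendsto_const_nhds (x := (1 : ℝ))).sub ((hz.pow 2).div_atTop hm)
    simpa using this.sqrt
  have h2 : Tendsto (fun p : ℕ × (ℝ × ℝ) => √(1 - p.2.1 ^ 2))
      (atTop ×ˢ nhds (0, a)) (nhds 1) := by
    have := (tendsto_const_nhds (x := (1 : ℝ))).sub (hρ.pow 2)
    simpa using this.sqrt
  have h3 : Tendsto (fun p : ℕ × (ℝ × ℝ) => √(p.1 + 1 : ℕ) / √p.1)
      (atTop ×ˢ nhds (0, a)) (nhds 1) := by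
    have h4 : Tendsto (fun p : ℕ × (ℝ × ℝ) => √(1 + 1 / p.1))
        (atTop ×ˢ nhds (0, a)) (nhds 1) := by
      have := (tendsto_const_nhds (x := (1 : ℝ))).add
        ((tendsto_const_nhds (x := (1 : ℝ))).div_atTop hm0)
      simpa using this.sqrt
    refine h4.congr' ?_
    filter_upwards [hm0.eventually_gt_atTop 0] with p hp
    rw [← Real.sqrt_div (by positivity)]
    congr 1
    push_cast
    field_simp
  have := (h1.mul h2).mul h3
  simpa [sliceScale] using this

/-- As `ρ → 0` the centre `ρ z` tends to `0` and the scale to `1`, so conditioning has no effect in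
the limit. This is asymptotic independence at the level of densities. -/
theorem exists_forall_condDensity_near (a : ℝ) {η : ℝ} (hη : 0 < η) :
    ∃ δ > 0, ∀ᶠ m : ℕ in atTop, ∀ ρ z y, |ρ| < δ → |z - a| < δ → |y - a| < δ →
      0 < sliceScale m ρ z ∧ |condDensity m ρ z y - gaussianPDFReal 0 1 a| < η := by
  let F : Filter (ℕ × (ℝ × ℝ × ℝ)) := atTop ×ˢ nhds (0, a, a)
  have hρ : Tendsto (fun p : ℕ × (ℝ × ℝ × ℝ) => p.2.1) F (nhds 0) :=
    (continuous_fst.tendsto ((0 : ℝ), a, a)).comp tendsto_snd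
  have hz : Tendsto (fun p : ℕ × (ℝ × ℝ × ℝ) => p.2.2.1) F (nhds a) :=
    ((continuous_fst.comp continuous_snd).tendsto ((0 : ℝ), a, a)).comp tendsto_snd
  have hy : Tendsto (fun p : ℕ × (ℝ × ℝ × ℝ) => p.2.2.2) F (nhds a) :=
    ((continuous_snd.comp continuous_snd).tendsto ((0 : ℝ), a, a)).comp tendsto_snd
  have hs : Tendsto (fun p : ℕ × (ℝ × ℝ × ℝ) => sliceScale p.1 p.2.1 p.2.2.1) F (nhds 1) := by
    have h1 : Tendsto (fun p : ℕ × (ℝ × ℝ × ℝ) => (p.1, (p.2.1, p.2.2.1))) F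
        (atTop ×ˢ nhds (0, a)) :=
      tendsto_fst.prodMk (hρ.prodMk_nhds hz)
    have := Tendsto.comp (tendsto_sliceScale a) h1
    exact this
  have hw : Tendsto (fun p : ℕ × (ℝ × ℝ × ℝ) =>
      (p.2.2.2 - p.2.1 * p.2.2.1) / sliceScale p.1 p.2.1 p.2.2.1) F (nhds a) := by
    have := (hy.sub (hρ.mul hz)).div hs one_ne_zero
    rw [zero_mul, sub_zero, div_one] at this
    exact this
  have hc : Tendsto (fun p : ℕ × (ℝ × ℝ × ℝ) => condDensity p.1 p.2.1 p.2.2.1 p.2.2.2) F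
      (nhds (gaussianPDFReal 0 1 a)) := by
    have h1 : Tendsto (fun p : ℕ × (ℝ × ℝ × ℝ) =>
        (p.1, (p.2.2.2 - p.2.1 * p.2.2.1) / sliceScale p.1 p.2.1 p.2.2.1)) F
        (atTop ×ˢ nhds a) := tendsto_fst.prodMk hw
    have h2 := (Tendsto.comp (tendsto_sliceDensity a) h1).div hs one_ne_zero
    rw [div_one] at h2
    exact h2
  have h := (hs.eventually_const_lt zero_lt_one).and (hc.eventually (Metric.ball_mem_nhds _ hη))
  obtain ⟨A, hA, B, hB, h⟩ := eventually_prod_iff.1 h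
  obtain ⟨δ, hδ, hB⟩ := Metric.eventually_nhds_iff.1 hB
  refine ⟨δ, hδ, hA.mono fun d hd ρ z y h1 h2 h3 => ?_⟩
  have hq : dist (ρ, z, y) (0, a, a) < δ := by
    simp only [Prod.dist_eq, Real.dist_eq, sub_zero]
    exact max_lt h1 (max_lt h2 h3)
  have h4 := h hd (hB hq)
  refine ⟨h4.1, ?_⟩
  exact h4.2

/-! ### Hit probabilities of one point and of two points -/

/-- The rescaled height `n (⟨x, √d u⟩ - a)`. -/
noncomputable def localHeight (n : ℕ) {d : ℕ} (a : ℝ) (x u : UnitSphere d) : ℝ :=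
  n * (√d * sphereInner x u - a)

theorem measurable_localHeight (n : ℕ) {d : ℕ} (a : ℝ) (x : UnitSphere d) :
    Measurable (localHeight n a x) := by
  unfold localHeight; fun_prop

/-- The heights `y` with `n (y - a) ∈ J`. -/
def heightWindow (n : ℕ) (a : ℝ) (J : Set ℝ) : Set ℝ := {y | n * (y - a) ∈ J}

theorem measurableSet_heightWindow (n : ℕ) (a : ℝ) {J : Set ℝ} (hJ : MeasurableSet J) :
    MeasurableSet (heightWindow n a J) :=
  (by fun_prop : Measurable fun y : ℝ => n * (y - a)) hJ

theorem volume_heightWindow {n : ℕ} (hn : n ≠ 0) (a : ℝ) {J : Set ℝ} (hJ : MeasurableSet J) :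
    volume (heightWindow n a J) = ENNReal.ofReal (n : ℝ)⁻¹ * volume J := by
  have hn' : (n : ℝ) ≠ 0 := by exact_mod_cast hn
  have h1 := lintegral_comp_mul_left_real (J.indicator 1) hn'
  have h2 := lintegral_sub_right_eq_self (μ := volume)
    (fun y => J.indicator (1 : ℝ → ENNReal) (n * y)) a
  rw [h1, lintegral_indicator_one hJ, abs_of_nonneg (by positivity)] at h2
  rw [← h2, ← lintegral_indicator_one (measurableSet_heightWindow n a hJ)]
  rfl

theorem abs_sub_le_of_mem_heightWindow {n : ℕ} (hn : n ≠ 0) {a R : ℝ} {J : Set ℝ}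
    (hJ : ∀ t ∈ J, |t| ≤ R) {y : ℝ} (hy : y ∈ heightWindow n a J) : |y - a| ≤ R / n := by
  have hn' : (0 : ℝ) < n := by positivity
  have := hJ _ hy
  rw [abs_mul, abs_of_pos hn'] at this
  rw [le_div_iff₀ hn']; linarith

theorem exists_abs_le_of_isBounded {J : Set ℝ} (hJ : Bornology.IsBounded J) :
    ∃ R, 0 < R ∧ ∀ t ∈ J, |t| ≤ R := by
  obtain ⟨R, hR, h⟩ := hJ.exists_pos_norm_le
  exact ⟨R, hR, fun t ht => by simpa using h t ht⟩

theorem eventually_pair {P : ℕ → Prop} {Q : ℕ → Prop} (hP : ∀ᶠ n in atTop, P n)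
    (hQ : ∀ᶠ m in atTop, Q m) : ∀ᶠ p : ℕ × ℕ in atTop ×ˢ atTop, P p.1 ∧ Q p.2 :=
  hP.prod_mk hQ

theorem eventually_div_natCast_lt (R : ℝ) {δ : ℝ} (hδ : 0 < δ) :
    ∀ᶠ n : ℕ in atTop, R / n < δ :=
  (tendsto_const_div_atTop_nhds_zero_nat R).eventually_lt_const hδ

theorem setOf_localHeight_mem (n : ℕ) {d : ℕ} (a : ℝ) (x : UnitSphere d) (J : Set ℝ) :
    {u | localHeight n a x u ∈ J} = {u | √d * sphereInner x u ∈ heightWindow n a J} := rfl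

/-- The expected number of hits of a bounded set by one point. -/
theorem eventually_localHeight_mem (a : ℝ) {J : Set ℝ} (hJ : MeasurableSet J)
    (hJb : Bornology.IsBounded J) {η : ℝ} (hη : 0 < η) :
    ∀ᶠ p : ℕ × ℕ in atTop ×ˢ atTop, ∀ x : UnitSphere (p.2 + 1),
      |p.1 * (uniformSphere (p.2 + 1)).real {u | localHeight p.1 a x u ∈ J}
        - gaussianPDFReal 0 1 a * volume.real J| ≤ η := by
  obtain ⟨R, hR, hJR⟩ := exists_abs_le_of_isBounded hJb
  set v := volume.real J with hv
  have hv0 : 0 ≤ v := measureReal_nonneg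
  have hvt : volume J ≠ ⊤ := hJb.measure_lt_top.ne
  obtain ⟨δ, hδ, h⟩ := exists_forall_sliceDensity_near a (by positivity : 0 < η / (v + 1))
  filter_upwards [eventually_pair ((eventually_gt_atTop 0).and (eventually_div_natCast_lt R hδ))
    ((tendsto_add_atTop_nat 1).eventually h |>.and (eventually_ge_atTop 3))]
    with ⟨n, m⟩ ⟨⟨hn, hnR⟩, hd, hm⟩ x
  simp only at hn hnR hd hm x ⊢
  have : NeZero (m + 1) := ⟨by omega⟩
  have hn' : (0 : ℝ) < n := by exact_mod_cast hn
  set g := gaussianPDFReal 0 1 a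
  set P := uniformSphere (m + 1) {u | localHeight n a x u ∈ J} with hP
  have hB := measurableSet_heightWindow n a hJ
  have hnear : ∀ z ∈ heightWindow n a J, |sliceDensity (m + 1) z - g| < η / (v + 1) :=
    fun z hz => hd z ((abs_sub_le_of_mem_heightWindow hn.ne' hJR hz).trans_lt hnR)
  have hup := uniformSphere_height_le hm x hB (M := g + η / (v + 1))
    fun z hz => by have := abs_lt.1 (hnear z hz); linarith
  have hlo := le_uniformSphere_height hm x hB (M := g - η / (v + 1))
    fun z hz => by have := abs_lt.1 (hnear z hz); linarith
  have hg : 0 ≤ g := gaussianPDFReal_nonneg _ _ _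
  have hPt : P ≠ ⊤ := measure_ne_top _ _
  rw [← setOf_localHeight_mem, ← hP, volume_heightWindow hn.ne' a hJ] at hup hlo
  have hup' := ENNReal.toReal_mono (by finiteness) hup
  have hlo' := ENNReal.toReal_mono hPt hlo
  simp only [ENNReal.toReal_mul, ENNReal.toReal_ofReal (by positivity : 0 ≤ g + η / (v + 1)),
    ENNReal.toReal_ofReal (by positivity : 0 ≤ (n : ℝ)⁻¹)] at hup' hlo'
  change _ ≤ _ * (_ * v) at hup'
  change _ * (_ * v) ≤ _ at hlo'
  have hlo2 : g - η / (v + 1) ≤ (ENNReal.ofReal (g - η / (v + 1))).toReal := by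
    rw [ENNReal.toReal_ofReal']; exact le_max_left _ _
  have hlo3 : (g - η / (v + 1)) * ((n : ℝ)⁻¹ * v) ≤ P.toReal :=
    (mul_le_mul_of_nonneg_right hlo2 (by positivity)).trans hlo'
  have e1 : n * ((g + η / (v + 1)) * ((n : ℝ)⁻¹ * v)) = g * v + η / (v + 1) * v := by
    field_simp
  have e2 : n * ((g - η / (v + 1)) * ((n : ℝ)⁻¹ * v)) = g * v - η / (v + 1) * v := by
    field_simp
  have e3 : η / (v + 1) * v ≤ η := by
    rw [div_mul_eq_mul_div, div_le_iff₀ (by positivity)]; nlinarith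
  have h1 := mul_le_mul_of_nonneg_left hup' hn'.le
  have h2 := mul_le_mul_of_nonneg_left hlo3 hn'.le
  rw [abs_le]
  change -η ≤ n * P.toReal - _ ∧ n * P.toReal - _ ≤ η
  constructor <;> linarith

theorem measureReal_pair_le {n m : ℕ} (hn : 0 < n) (hm : 4 ≤ m) (a : ℝ) (x y : UnitSphere (m + 1))
    {J J' : Set ℝ} (hJ : MeasurableSet J) (hJ' : MeasurableSet J') (hJt : volume J ≠ ⊤)
    (hJt' : volume J' ≠ ⊤) {M N : ℝ} (hM0 : 0 ≤ M) (hN0 : 0 ≤ N)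
    (hM : ∀ z ∈ heightWindow n a J, sliceDensity (m + 1) z ≤ M)
    (hs : ∀ z ∈ heightWindow n a J, 0 < sliceScale m (sphereInner x y) z)
    (hN : ∀ z ∈ heightWindow n a J, ∀ w ∈ heightWindow n a J',
      condDensity m (sphereInner x y) z w ≤ N) :
    (n : ℝ) ^ 2 * (uniformSphere (m + 1)).real
        {u | localHeight n a x u ∈ J ∧ localHeight n a y u ∈ J'}
      ≤ M * N * (volume.real J * volume.real J') := by
  have h := uniformSphere_pair_le hm x y (measurableSet_heightWindow n a hJ)
    (measurableSet_heightWindow n a hJ') hM0 hM hs hN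
  rw [volume_heightWindow hn.ne' a hJ, volume_heightWindow hn.ne' a hJ'] at h
  have h' := ENNReal.toReal_mono (by finiteness) h
  simp only [ENNReal.toReal_mul, ENNReal.toReal_ofReal (by positivity : 0 ≤ M * N),
    ENNReal.toReal_ofReal (by positivity : 0 ≤ (n : ℝ)⁻¹)] at h'
  have hn' : (0 : ℝ) < n := by exact_mod_cast hn
  calc _ ≤ (n : ℝ) ^ 2 * (M * N * (((n : ℝ)⁻¹ * volume.real J) * ((n : ℝ)⁻¹ * volume.real J'))) :=
        mul_le_mul_of_nonneg_left h' (by positivity)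
    _ = _ := by field_simp

/-- Asymptotic pairwise independence of almost orthogonal points. -/
theorem exists_forall_pair_le (a : ℝ) {J J' : Set ℝ} (hJ : MeasurableSet J)
    (hJ' : MeasurableSet J') (hJb : Bornology.IsBounded J) (hJb' : Bornology.IsBounded J')
    {η : ℝ} (hη : 0 < η) :
    ∃ ε > 0, ∀ᶠ p : ℕ × ℕ in atTop ×ˢ atTop, ∀ x y : UnitSphere (p.2 + 1),
      |sphereInner x y| < ε →
      (p.1 : ℝ) ^ 2 * (uniformSphere (p.2 + 1)).real
          {u | localHeight p.1 a x u ∈ J ∧ localHeight p.1 a y u ∈ J'}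
        ≤ gaussianPDFReal 0 1 a ^ 2 * (volume.real J * volume.real J') + η := by
  obtain ⟨R, hR, hJR⟩ := exists_abs_le_of_isBounded (hJb.union hJb')
  set V := volume.real J * volume.real J' with hV
  have hV0 : 0 ≤ V := mul_nonneg measureReal_nonneg measureReal_nonneg
  set g := gaussianPDFReal 0 1 a
  have hg : 0 ≤ g := gaussianPDFReal_nonneg _ _ _
  obtain ⟨θ, hθ, hθη⟩ : ∃ θ > 0, (g + θ) * (g + θ) * V ≤ g ^ 2 * V + η := by
    have hc : Tendsto (fun θ : ℝ => (g + θ) * (g + θ) * V) (nhds 0) (nhds (g ^ 2 * V)) := by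
      have : Continuous fun θ : ℝ => (g + θ) * (g + θ) * V := by fun_prop
      simpa [sq] using this.tendsto 0
    have h1 := (hc.eventually_lt_const (by linarith : g ^ 2 * V < g ^ 2 * V + η))
    obtain ⟨θ, h2, h3⟩ := ((h1.filter_mono nhdsWithin_le_nhds).and
      (self_mem_nhdsWithin : Set.Ioi (0 : ℝ) ∈ nhdsWithin 0 (Set.Ioi 0))).exists
    exact ⟨θ, h3, h2.le⟩
  obtain ⟨δ, hδ, h⟩ := exists_forall_sliceDensity_near a hθ
  obtain ⟨δ', hδ', h'⟩ := exists_forall_condDensity_near a hθ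
  refine ⟨δ', hδ', ?_⟩
  filter_upwards [eventually_pair ((eventually_gt_atTop 0).and ((eventually_div_natCast_lt R hδ).and
    (eventually_div_natCast_lt R hδ')))
    ((tendsto_add_atTop_nat 1).eventually h |>.and ((eventually_ge_atTop 4).and h'))]
    with ⟨n, m⟩ ⟨⟨hn, hnR, hnR'⟩, hd, hm, hc⟩ x y hxy
  simp only at hn hnR hnR' hd hm hc x y hxy ⊢
  have hnear : ∀ z ∈ heightWindow n a J, |z - a| ≤ R / n := fun z hz =>
    abs_sub_le_of_mem_heightWindow hn.ne' (fun t ht => hJR t (Or.inl ht)) hz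
  have hnear' : ∀ z ∈ heightWindow n a J', |z - a| ≤ R / n := fun z hz =>
    abs_sub_le_of_mem_heightWindow hn.ne' (fun t ht => hJR t (Or.inr ht)) hz
  refine (measureReal_pair_le hn hm a x y hJ hJ' hJb.measure_lt_top.ne hJb'.measure_lt_top.ne
    (M := g + θ) (N := g + θ) (by positivity) (by positivity) (fun z hz => ?_) (fun z hz => ?_)
    (fun z hz w hw => ?_)).trans hθη
  · have := abs_lt.1 (hd z ((hnear z hz).trans_lt hnR)); linarith
  · exact (hc _ z a hxy ((hnear z hz).trans_lt hnR') (by simpa using hδ')).1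
  · have := abs_lt.1 (hc _ z w hxy ((hnear z hz).trans_lt hnR') ((hnear' w hw).trans_lt hnR')).2
    linarith

/-- The radius of the slice is at least `√(1 - 3 / 4) = 1 / 2` and the ratio of dimensions at least
`1`. Only `√(1 - ρ²)` can be small, which is the origin of `1 / √(1 - |ρ|)` in the pair weight. -/
theorem le_sliceScale {m : ℕ} (hm : 0 < m) {ρ z : ℝ} (hz : z ^ 2 ≤ 3 / 4 * m) :
    √(1 - ρ ^ 2) / 2 ≤ sliceScale m ρ z := by
  have hm' : (0 : ℝ) < m := by exact_mod_cast hm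
  have h1 : 1 / 2 ≤ √(1 - z ^ 2 / (m + 1 : ℕ)) := by
    apply Real.le_sqrt_of_sq_le
    have : z ^ 2 / (m + 1 : ℕ) ≤ 3 / 4 := by
      rw [div_le_iff₀ (by positivity)]; push_cast; linarith
    linarith
  have h2 : 1 ≤ √(m + 1 : ℕ) / √m := by
    rw [one_le_div (by positivity)]
    exact Real.sqrt_le_sqrt (by push_cast; linarith)
  have h3 := Real.sqrt_nonneg (1 - ρ ^ 2)
  rw [sliceScale]
  calc √(1 - ρ ^ 2) / 2 = 1 / 2 * √(1 - ρ ^ 2) * 1 := by ring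
    _ ≤ _ := by gcongr

theorem eventually_sq_le (R : ℝ) : ∀ᶠ m : ℕ in atTop, R ^ 2 ≤ 3 / 4 * m := by
  filter_upwards [tendsto_natCast_atTop_atTop.eventually_ge_atTop (4 / 3 * R ^ 2)] with m hm
  linarith

/-- Two points of inner product `ρ` hit bounded sets with probability
`O (n⁻² min (1 / √(1 - |ρ|), n))`. -/
theorem exists_forall_pair_le_pairWeight (a : ℝ) {J J' : Set ℝ} (hJ : MeasurableSet J)
    (hJ' : MeasurableSet J') (hJb : Bornology.IsBounded J) (hJb' : Bornology.IsBounded J') :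
    ∃ C, 0 ≤ C ∧ ∀ᶠ p : ℕ × ℕ in atTop ×ˢ atTop, ∀ x y : UnitSphere (p.2 + 1),
      (p.1 : ℝ) ^ 2 * (uniformSphere (p.2 + 1)).real
          {u | localHeight p.1 a x u ∈ J ∧ localHeight p.1 a y u ∈ J'}
        ≤ C * pairWeight p.1 (sphereInner x y) := by
  obtain ⟨R, hR, hJR⟩ := exists_abs_le_of_isBounded hJb
  set V := volume.real J * volume.real J' with hV
  have hV0 : 0 ≤ V := mul_nonneg measureReal_nonneg measureReal_nonneg
  set W := gaussianPDFReal 0 1 a * volume.real J + 1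
  have hW0 : 0 ≤ W := by
    have : 0 ≤ gaussianPDFReal 0 1 a * volume.real J :=
      mul_nonneg (gaussianPDFReal_nonneg _ _ _) measureReal_nonneg
    positivity
  refine ⟨2 * V + W, by positivity, ?_⟩
  filter_upwards [eventually_localHeight_mem a hJ hJb one_pos, eventually_pair
    (eventually_ge_atTop 1)
    ((tendsto_add_atTop_nat 1).eventually eventually_sliceDensity_le_one |>.and
    ((eventually_ge_atTop 4).and (eventually_sliceDensity_le_one.and
      (eventually_sq_le (|a| + R)))))]
    with ⟨n, m⟩ h1 ⟨hn, hd, hm, hd', hR2⟩ x y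
  simp only at h1 hn hd hm hd' hR2 x y ⊢
  have : NeZero (m + 1) := ⟨by omega⟩
  have hn' : (1 : ℝ) ≤ n := by exact_mod_cast hn
  set P := (uniformSphere (m + 1)).real {u | localHeight n a x u ∈ J ∧ localHeight n a y u ∈ J'}
  -- Forgetting the second point gives `P ≤ W / n`; this is the alternative `n` in the minimum, and
  -- all that is available at `|ρ| = 1`.
  have hP1 : (n : ℝ) ^ 2 * P ≤ W * n := by
    have h2 := (abs_le.1 (h1 x)).2
    have h3 : P ≤ (uniformSphere (m + 1)).real {u | localHeight n a x u ∈ J} :=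
      measureReal_mono fun u hu => hu.1
    have h4 : n * P ≤ W := (mul_le_mul_of_nonneg_left h3 (by positivity)).trans (by linarith)
    nlinarith
  have hP2 : (n : ℝ) ^ 2 * P ≤ (2 * V + W) * n := hP1.trans (by gcongr; linarith)
  rw [pairWeight]
  split_ifs with hρ
  · set ρ := sphereInner x y
    have hρ1 : 0 < 1 - |ρ| := by linarith
    have hsq : √(1 - |ρ|) ≤ √(1 - ρ ^ 2) := by
      apply Real.sqrt_le_sqrt
      rw [← sq_abs]; nlinarith [abs_nonneg ρ]
    have hs0 : 0 < √(1 - |ρ|) := Real.sqrt_pos.2 hρ1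
    have hz : ∀ z ∈ heightWindow n a J, √(1 - |ρ|) / 2 ≤ sliceScale m ρ z := by
      intro z hz
      have h5 := abs_sub_le_of_mem_heightWindow (by omega) hJR hz
      have h6 : |z| ≤ |a| + R := by
        have : R / n ≤ R := div_le_self hR.le hn'
        have := abs_sub_abs_le_abs_sub z a
        linarith
      have h7 : z ^ 2 ≤ (|a| + R) ^ 2 := by
        rw [← sq_abs z]; gcongr
      refine le_trans ?_ (le_sliceScale (by omega) (h7.trans hR2))
      linarith
    have h8 := measureReal_pair_le (N := 2 / √(1 - |ρ|)) (by omega) hm a x y hJ hJ'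
      hJb.measure_lt_top.ne hJb'.measure_lt_top.ne zero_le_one (by positivity) (fun z _ => hd z)
      (fun z hz' => (by positivity : 0 < √(1 - |ρ|) / 2).trans_le (hz z hz'))
      (fun z hz' w _ => by
        have h9 := hz z hz'
        have h10 : 0 < sliceScale m ρ z := (by positivity : 0 < √(1 - |ρ|) / 2).trans_le h9
        rw [condDensity, div_le_div_iff₀ h10 hs0]
        have := hd' ((w - ρ * z) / sliceScale m ρ z)
        nlinarith)
    rw [mul_min_of_nonneg _ _ (by positivity)]
    refine le_min (h8.trans ?_) hP2
    rw [← hV]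
    calc 1 * (2 / √(1 - |ρ|)) * V = 2 * V * (1 / √(1 - |ρ|)) := by ring
      _ ≤ _ := by gcongr; linarith
  · exact hP2

/-! ### Stability of the hit counts under shifts of order `1 / n` -/

/-- Squeeze `I` between a compact `F` and an open `O` with `O \ F` small. A short move out of `I`
starting in `F` ends in `O \ F`, and one starting elsewhere in `I` begins there. The layer replaces
the topological boundary, which may have positive measure for a Borel set. -/
theorem exists_boundary_layer {I : Set ℝ} (hI : MeasurableSet I) (hIb : Bornology.IsBounded I)
    {η : ℝ} (hη : 0 < η) :
    ∃ δ > 0, ∃ D, MeasurableSet D ∧ volume D ≤ ENNReal.ofReal η ∧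
      ∀ t t', |t - t'| < δ → t ∈ I → t' ∉ I → t ∈ D ∨ t' ∈ D := by
  have hIt : volume I ≠ ⊤ := hIb.measure_lt_top.ne
  have hη' : ENNReal.ofReal (η / 2) ≠ 0 := by simpa using hη
  obtain ⟨F, hFI, hF, hFv⟩ := hI.exists_isCompact_sdiff_lt hIt hη'
  obtain ⟨O, hIsub, hO, -, hOv⟩ := hI.exists_isOpen_sdiff_lt hIt hη'
  obtain ⟨δ, hδ, hFthick⟩ := hF.exists_thickening_subset_open hO (hFI.trans hIsub)
  refine ⟨δ, hδ, O \ F, hO.measurableSet.diff hF.measurableSet, ?_, fun t t' htt' ht ht' => ?_⟩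
  · calc volume (O \ F) ≤ volume (O \ I ∪ I \ F) := measure_mono fun t ht => by
          by_cases h : t ∈ I
          · exact Or.inr ⟨h, ht.2⟩
          · exact Or.inl ⟨ht.1, h⟩
      _ ≤ ENNReal.ofReal (η / 2) + ENNReal.ofReal (η / 2) :=
          (measure_union_le _ _).trans (add_le_add hOv.le hFv.le)
      _ = ENNReal.ofReal η := by
          rw [← ENNReal.ofReal_add (by positivity) (by positivity), add_halves]
  · by_cases htF : t ∈ F
    · refine Or.inr ⟨hFthick (Metric.mem_thickening_iff.2 ⟨t, htF, ?_⟩), fun h => ht' (hFI h)⟩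
      rwa [dist_comm, Real.dist_eq]
    · exact Or.inl ⟨hIsub ht, htF⟩

/-- A shift of order `1 / n` of the slice moves the heights of points almost orthogonal to the
axis by `o(1 / n)`. -/
theorem exists_forall_sliceHeight_sub_lt (B s : ℝ) {δ : ℝ} (hδ : 0 < δ) :
    ∃ ε > 0, ∀ᶠ m : ℕ in atTop, ∀ n : ℕ, 0 < n → ∀ ρ z z' q : ℝ, |ρ| < ε → |z| ≤ B → |z'| ≤ B →
      |z - z'| ≤ |s| / n → |sliceHeight m ρ z q| ≤ B →
      n * |sliceHeight m ρ z q - sliceHeight m ρ z' q| < δ := by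
  -- The term `ρ z` moves by at most `|ρ| |s| / n`, which takes half of `δ`. The other half covers
  -- the change of the radius of the slice, which is `O(1 / (n m))`.
  refine ⟨min 1 (δ / (2 * (|s| + 1))), by positivity, ?_⟩
  filter_upwards [eventually_sq_le B, eventually_div_natCast_lt (8 * B ^ 2 * |s|) (half_pos hδ),
    eventually_gt_atTop 0] with m hm hms hm0 n hn ρ z z' q hρ hz hz' hzz' hh
  have hn' : (0 : ℝ) < n := by exact_mod_cast hn
  have hm' : (0 : ℝ) < m := by exact_mod_cast hm0
  have hB : 0 ≤ B := (abs_nonneg _).trans hz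
  have hroot : ∀ y, |y| ≤ B → 1 / 2 ≤ √(1 - y ^ 2 / (m + 1 : ℕ)) ∧
      √(1 - y ^ 2 / (m + 1 : ℕ)) ^ 2 = 1 - y ^ 2 / (m + 1 : ℕ) := by
    intro y hy
    have h1 : y ^ 2 / (m + 1 : ℕ) ≤ 3 / 4 := by
      rw [div_le_iff₀ (by positivity)]
      have : y ^ 2 ≤ B ^ 2 := by rw [← sq_abs y]; gcongr
      push_cast; linarith
    exact ⟨Real.le_sqrt_of_sq_le (by linarith), Real.sq_sqrt (by linarith)⟩
  obtain ⟨hr, hr2⟩ := hroot z hz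
  obtain ⟨hr', hr2'⟩ := hroot z' hz'
  unfold sliceHeight at hh ⊢
  set r := √(1 - z ^ 2 / (m + 1 : ℕ))
  set r' := √(1 - z' ^ 2 / (m + 1 : ℕ))
  set c := √(1 - ρ ^ 2) * (√(m + 1 : ℕ) * q)
  have hρ1 : |ρ| ≤ 1 := (hρ.trans_le (min_le_left _ _)).le
  have hρ2 : |ρ| * |s| ≤ δ / 2 := by
    have h2 := (hρ.trans_le (min_le_right _ _)).le
    rw [le_div_iff₀ (by positivity)] at h2
    nlinarith [abs_nonneg ρ, abs_nonneg s]
  -- The transversal coordinate `√d q` has no bound of its own. It is controlled because the height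
  -- at `z` is at most `B` and the radius `r` is at least `1 / 2`.
  have hc : |c| ≤ 4 * B := by
    have h3 : |r * c| ≤ |ρ * z + r * c| + |ρ * z| := by
      have := abs_sub (ρ * z + r * c) (ρ * z)
      rwa [add_sub_cancel_left] at this
    have h4 : |ρ * z| ≤ B := by
      rw [abs_mul]; nlinarith [abs_nonneg ρ, abs_nonneg z]
    have h5 : |r * c| = r * |c| := by rw [abs_mul, abs_of_pos (by linarith)]
    nlinarith [abs_nonneg c]
  have hrr : |r - r'| ≤ 2 * B * |s| / (n * m) := by
    have h6 : |r - r'| ≤ |r ^ 2 - r' ^ 2| := by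
      rw [sq_sub_sq, abs_mul, abs_of_pos (by linarith : 0 < r + r')]
      nlinarith [abs_nonneg (r - r')]
    have h7 : r ^ 2 - r' ^ 2 = (z' + z) * (z' - z) / (m + 1 : ℕ) := by
      rw [hr2, hr2']; ring
    have h8 : |z' + z| ≤ 2 * B := (abs_add_le _ _).trans (by linarith)
    calc |r - r'| ≤ |z' + z| * |z' - z| / (m + 1 : ℕ) := by
          rw [h7, abs_div, abs_mul, abs_of_pos (by positivity : (0 : ℝ) < (m + 1 : ℕ))] at h6
          exact h6
      _ ≤ (2 * B) * (|s| / n) / m := by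
          rw [abs_sub_comm] at hzz'
          gcongr
          linarith
      _ = _ := by field_simp
  have hmain : |ρ * z + r * c - (ρ * z' + r' * c)| ≤ |ρ| * (|s| / n)
      + 2 * B * |s| / (n * m) * (4 * B) := by
    have h9 : ρ * z + r * c - (ρ * z' + r' * c) = ρ * (z - z') + (r - r') * c := by ring
    rw [h9]
    refine (abs_add_le _ _).trans ?_
    rw [abs_mul, abs_mul]
    gcongr
  calc _ ≤ n * (|ρ| * (|s| / n) + 2 * B * |s| / (n * m) * (4 * B)) := by gcongr
    _ = |ρ| * |s| + 8 * B ^ 2 * |s| / m := by field_simp; ring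
    _ < δ := by linarith

/-- The number of `i ∈ S` with `h i ∈ B`. -/
noncomputable def hitCount {κ : Type*} (S : Finset κ) (B : Set ℝ) (h : κ → ℝ) : ℕ :=
  ∑ i ∈ S, B.indicator 1 (h i)

theorem measurable_hitCount {κ : Type*} (S : Finset κ) {B : Set ℝ} (hB : MeasurableSet B) :
    Measurable (hitCount S B) := by
  unfold hitCount
  exact Finset.measurable_fun_sum _ fun i _ =>
    (measurable_one.indicator hB).comp (measurable_pi_apply i)

theorem exists_mem_of_hitCount_ne {κ : Type*} {S : Finset κ} {B : Set ℝ} {h h' : κ → ℝ}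
    (hne : hitCount S B h ≠ hitCount S B h') :
    ∃ i ∈ S, (h i ∈ B ∧ h' i ∉ B) ∨ (h' i ∈ B ∧ h i ∉ B) := by
  by_contra! hcon
  refine hne (Finset.sum_congr rfl fun i hi => ?_)
  have := hcon i hi
  by_cases h1 : h i ∈ B
  · have h2 : h' i ∈ B := by tauto
    rw [Set.indicator_of_mem h1, Set.indicator_of_mem h2]; rfl
  · have h2 : h' i ∉ B := by tauto
    rw [Set.indicator_of_notMem h1, Set.indicator_of_notMem h2]

@[fun_prop]
theorem measurable_sliceHeight (m : ℕ) (ρ z : ℝ) (x : UnitSphere m) :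
    Measurable fun v => sliceHeight m ρ z (sphereInner x v) := by
  unfold sliceHeight; fun_prop

/-- The law of the number of hits in a slice changes little under shifts of order `1 / n`. -/
theorem exists_forall_fiber_shift (a : ℝ) {I : Set ℝ} (hI : MeasurableSet I)
    (hIb : Bornology.IsBounded I) (R s : ℝ) {η : ℝ} (hη : 0 < η) :
    ∃ ε > 0, ∀ᶠ p : ℕ × ℕ in atTop ×ˢ atTop, ∀ (w : Fin p.1 → UnitSphere p.2) (ρ : Fin p.1 → ℝ)
      (S : Finset (Fin p.1)), (∀ i ∈ S, |ρ i| < ε) → ∀ z z' : ℝ, |z - a| ≤ R → |z' - a| ≤ R →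
      |z - z'| ≤ |s| / p.1 → ∀ k,
      uniformSphere p.2 {v | hitCount S (heightWindow p.1 a I)
          (fun i => sliceHeight p.2 (ρ i) z (sphereInner (w i) v)) = k}
        ≤ uniformSphere p.2 {v | hitCount S (heightWindow p.1 a I)
          (fun i => sliceHeight p.2 (ρ i) z' (sphereInner (w i) v)) = k} + ENNReal.ofReal η := by
  -- With conditional densities at most `4`, a point lies in the rescaled layer with probability at
  -- most `4 (η / 8) / n = η / (2 n)`. Two slices and at most `n` points give `η` in total.
  obtain ⟨δ, hδ, D, hD, hDv, hDI⟩ := exists_boundary_layer hI hIb (by positivity : 0 < η / 8)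
  obtain ⟨RI, hRI, hIR⟩ := exists_abs_le_of_isBounded hIb
  set B := |a| + |R| + RI
  obtain ⟨ε, hε, h⟩ := exists_forall_sliceHeight_sub_lt B s hδ
  refine ⟨min ε (1 / 2), by positivity, ?_⟩
  filter_upwards [eventually_pair (eventually_gt_atTop 0)
    (h.and ((eventually_ge_atTop 4).and (eventually_sliceDensity_le_one.and (eventually_sq_le B))))]
    with ⟨n, m⟩ ⟨hn, hm, hm4, hd, hB2⟩ w ρ S hρ z z' hz hz' hzz' k
  simp only at hn hm hm4 hd hB2 w ρ S hρ hzz' ⊢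
  have hn' : (1 : ℝ) ≤ n := by exact_mod_cast hn
  have hbd : ∀ y, |y - a| ≤ R → |y| ≤ B := fun y hy => by
    have h1 := abs_sub_abs_le_abs_sub y a
    have h2 := le_abs_self R
    simp only [B]; linarith
  have hwin : ∀ y ∈ heightWindow n a I, |y| ≤ B := fun y hy => by
    have h1 := abs_sub_le_of_mem_heightWindow hn.ne' hIR hy
    have h2 : RI / n ≤ RI := div_le_self hRI.le hn'
    have h3 := abs_sub_abs_le_abs_sub y a
    have h4 := abs_nonneg R
    simp only [B]; linarith
  set W := heightWindow n a I
  set L := heightWindow n a D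
  have hL : MeasurableSet L := measurableSet_heightWindow n a hD
  have hfib : ∀ i ∈ S, ∀ y, |y - a| ≤ R →
      uniformSphere m {v | sliceHeight m (ρ i) y (sphereInner (w i) v) ∈ L}
        ≤ ENNReal.ofReal (η / (2 * n)) := by
    intro i hi y hy
    have h1 : |ρ i| ≤ 1 / 2 := ((hρ i hi).trans_le (min_le_right _ _)).le
    have h2 : 1 / 2 ≤ √(1 - ρ i ^ 2) := by
      apply Real.le_sqrt_of_sq_le
      rw [← sq_abs (ρ i)]; nlinarith [abs_nonneg (ρ i)]
    have h3 : y ^ 2 ≤ 3 / 4 * m := by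
      refine le_trans ?_ hB2
      rw [← sq_abs y]; gcongr; exact hbd y hy
    have h4 : 1 / 4 ≤ sliceScale m (ρ i) y := le_trans (by linarith) (le_sliceScale (by omega) h3)
    refine (uniformSphere_sliceHeight_le hm4 (w i) hL (by linarith) (N := 4) fun t _ => ?_).trans ?_
    · rw [condDensity, div_le_iff₀ (by linarith)]
      have := hd ((t - ρ i * y) / sliceScale m (ρ i) y)
      linarith
    · rw [volume_heightWindow hn.ne' a hD]
      calc _ ≤ ENNReal.ofReal 4 * (ENNReal.ofReal (n : ℝ)⁻¹ * ENNReal.ofReal (η / 8)) := by gcongr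
        _ = _ := by
          rw [← ENNReal.ofReal_mul (by positivity), ← ENNReal.ofReal_mul (by positivity)]
          congr 1; field_simp; norm_num
  -- If the counts differ, some point is in the window for one of `z, z'` and out of it for the
  -- other. Its height is bounded on the side where it is in the window, so it moves by less than `δ
  -- / n` and meets the layer.
  have hsub : {v | hitCount S W (fun i => sliceHeight m (ρ i) z (sphereInner (w i) v)) = k} ⊆
      {v | hitCount S W (fun i => sliceHeight m (ρ i) z' (sphereInner (w i) v)) = k} ∪
      ⋃ i ∈ S, ({v | sliceHeight m (ρ i) z (sphereInner (w i) v) ∈ L} ∪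
        {v | sliceHeight m (ρ i) z' (sphereInner (w i) v) ∈ L}) := by
    intro v hv
    by_cases hv' : hitCount S W (fun i => sliceHeight m (ρ i) z' (sphereInner (w i) v)) = k
    · exact Or.inl hv'
    · refine Or.inr ?_
      have hv : hitCount S W (fun i => sliceHeight m (ρ i) z (sphereInner (w i) v)) = k := hv
      obtain ⟨i, hi, hor⟩ := exists_mem_of_hitCount_ne (hv.trans_ne (Ne.symm hv'))
      have hρi := (hρ i hi).trans_le (min_le_left _ _)
      simp only [Set.mem_iUnion]
      refine ⟨i, hi, ?_⟩
      rcases hor with ⟨h1, h2⟩ | ⟨h1, h2⟩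
      · have h3 := hm n hn (ρ i) z z' (sphereInner (w i) v) hρi (hbd z hz) (hbd z' hz') hzz'
          (hwin _ h1)
        refine hDI _ _ ?_ h1 h2
        rw [← mul_sub, sub_sub_sub_cancel_right, abs_mul, abs_of_pos (by linarith)]
        exact h3
      · have h3 := hm n hn (ρ i) z' z (sphereInner (w i) v) hρi (hbd z' hz') (hbd z hz)
          (by rwa [abs_sub_comm]) (hwin _ h1)
        refine (hDI _ _ ?_ h1 h2).symm
        rw [← mul_sub, sub_sub_sub_cancel_right, abs_mul, abs_of_pos (by linarith)]
        exact h3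
  refine (measure_mono hsub).trans ((measure_union_le _ _).trans (add_le_add le_rfl ?_))
  calc _ ≤ ∑ i ∈ S, uniformSphere m ({v | sliceHeight m (ρ i) z (sphereInner (w i) v) ∈ L} ∪
        {v | sliceHeight m (ρ i) z' (sphereInner (w i) v) ∈ L}) := measure_biUnion_finset_le _ _
    _ ≤ ∑ i ∈ S, ENNReal.ofReal (η / n) := by
        refine Finset.sum_le_sum fun i hi => (measure_union_le _ _).trans ?_
        refine (add_le_add (hfib i hi z hz) (hfib i hi z' hz')).trans (le_of_eq ?_)
        rw [← ENNReal.ofReal_add (by positivity) (by positivity)]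
        congr 1; field_simp; norm_num
    _ = ENNReal.ofReal (S.card * (η / n)) := by
        rw [Finset.sum_const, nsmul_eq_mul, ENNReal.ofReal_mul (by positivity),
          ENNReal.ofReal_natCast]
    _ ≤ _ := by
        apply ENNReal.ofReal_le_ofReal
        have : (S.card : ℝ) ≤ n := by
          exact_mod_cast (Finset.card_le_univ S).trans_eq (Fintype.card_fin n)
        calc S.card * (η / n) ≤ n * (η / n) := by gcongr
          _ = η := by field_simp

theorem exists_uniformSphere_slice_inter {m : ℕ} (hm : 3 ≤ m) (e : UnitSphere (m + 1)) :
    ∃ π : UnitSphere (m + 1) → UnitSphere m, ∀ (κ : Type) [Countable κ]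
      (y : κ → UnitSphere (m + 1)) (A : Set ℝ) (E : Set (κ → ℝ)), MeasurableSet A →
      MeasurableSet E →
      uniformSphere (m + 1) {u | √(m + 1 : ℕ) * sphereInner e u ∈ A ∧
          (fun i => √(m + 1 : ℕ) * sphereInner (y i) u) ∈ E}
        = ∫⁻ z in A, ENNReal.ofReal (sliceDensity (m + 1) z) * uniformSphere m
          {v | (fun i => sliceHeight m (sphereInner (y i) e) z (sphereInner (π (y i)) v)) ∈ E} := by
  obtain ⟨π, h⟩ := exists_slice_projection hm e
  refine ⟨π, fun κ _ y A E hA hE => ?_⟩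
  have hAE : MeasurableSet (A ×ˢ E) := hA.prod hE
  have hm1 : Measurable fun u : UnitSphere (m + 1) =>
      (√(m + 1 : ℕ) * sphereInner e u, fun i => √(m + 1 : ℕ) * sphereInner (y i) u) := by
    fun_prop
  refine (lintegral_indicator_one (hm1 hAE)).symm.trans
    ((h κ y ((A ×ˢ E).indicator 1) (measurable_one.indicator hAE)).trans ?_)
  rw [← lintegral_indicator hA]
  refine lintegral_congr fun z => ?_
  by_cases hz : z ∈ A
  · rw [Set.indicator_of_mem hz]
    congr 1
    have hm2 : Measurable fun v : UnitSphere m => fun i =>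
        sliceHeight m (sphereInner (y i) e) z (sphereInner (π (y i)) v) := by fun_prop
    refine Eq.trans (lintegral_congr fun v => ?_) (lintegral_indicator_one (hm2 hE))
    by_cases hv : (fun i => sliceHeight m (sphereInner (y i) e) z (sphereInner (π (y i)) v)) ∈ E
    · rw [Set.indicator_of_mem (by exact ⟨hz, hv⟩), Set.indicator_of_mem (by exact hv)]; rfl
    · rw [Set.indicator_of_notMem (fun h => hv h.2), Set.indicator_of_notMem (by exact hv)]
  · rw [Set.indicator_of_notMem hz]
    have : ∀ q, (A ×ˢ E).indicator (1 : ℝ × (κ → ℝ) → ENNReal) (z, q) = 0 := fun q =>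
      Set.indicator_of_notMem (fun h => hz h.1) _
    simp [this]

/-- Shifting the hitting condition of one point hardly changes its joint law with the number of
hits of the points almost orthogonal to it. -/
theorem exists_forall_shift_le (a : ℝ) {I J : Set ℝ} (hI : MeasurableSet I)
    (hIb : Bornology.IsBounded I) (hJ : MeasurableSet J) (hJb : Bornology.IsBounded J)
    (s : ℝ) {η : ℝ} (hη : 0 < η) :
    ∃ ε > 0, ∀ᶠ p : ℕ × ℕ in atTop ×ˢ atTop, ∀ (x : UnitSphere (p.2 + 1))
      (y : Fin p.1 → UnitSphere (p.2 + 1)) (S : Finset (Fin p.1)),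
      (∀ i ∈ S, |sphereInner (y i) x| < ε) → ∀ k,
      p.1 * (uniformSphere (p.2 + 1)).real {u | localHeight p.1 a x u ∈ J ∧
          hitCount S I (fun i => localHeight p.1 a (y i) u) = k}
        ≤ p.1 * (uniformSphere (p.2 + 1)).real {u | localHeight p.1 a x u + s ∈ J ∧
          hitCount S I (fun i => localHeight p.1 a (y i) u) = k} + η := by
  obtain ⟨R, hR, hJR⟩ := exists_abs_le_of_isBounded hJb
  set V := volume.real J with hV
  have hV0 : 0 ≤ V := measureReal_nonneg
  have hJt : volume J ≠ ⊤ := hJb.measure_lt_top.ne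
  -- One `θ` pays for the change of the density and one for the change of the fibre law, over a
  -- window of length `V / n`.
  obtain ⟨θ, hθ, hθη⟩ : ∃ θ > 0, 2 * θ * V ≤ η := by
    refine ⟨η / (2 * (V + 1)), by positivity, ?_⟩
    rw [show 2 * (η / (2 * (V + 1))) * V = η * V / (V + 1) by field_simp,
      div_le_iff₀ (by positivity)]
    nlinarith
  obtain ⟨δ, hδ, hf⟩ := exists_forall_sliceDensity_near a (half_pos hθ)
  obtain ⟨ε, hε, hfib⟩ := exists_forall_fiber_shift a hI hIb (R + |s|) s hθ
  refine ⟨ε, hε, ?_⟩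
  filter_upwards [hfib, eventually_pair ((eventually_gt_atTop 0).and
    (eventually_div_natCast_lt (R + |s|) hδ)) ((tendsto_add_atTop_nat 1).eventually
      (hf.and eventually_sliceDensity_le_one) |>.and (eventually_ge_atTop 3))]
    with ⟨n, m⟩ hfib ⟨⟨hn, hnδ⟩, ⟨hf, hf1⟩, hm⟩ x y S hS k
  simp only at hfib hn hnδ hf hf1 hm x y S hS ⊢
  have : NeZero (m + 1) := ⟨by omega⟩
  have : NeZero m := ⟨by omega⟩
  have hn' : (0 : ℝ) < n := by exact_mod_cast hn
  have hn1 : (1 : ℝ) ≤ n := by exact_mod_cast hn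
  obtain ⟨π, hπ⟩ := exists_uniformSphere_slice_inter hm x
  set W := heightWindow n a I
  set A := heightWindow n a J
  have hA : MeasurableSet A := measurableSet_heightWindow n a hJ
  have hW : MeasurableSet W := measurableSet_heightWindow n a hI
  let A' : Set ℝ := {z | z + s / n ∈ A}
  have hA' : MeasurableSet A' := (by fun_prop : Measurable fun z : ℝ => z + s / n) hA
  let E : Set (Fin n → ℝ) := {h | hitCount S W h = k}
  have hE : MeasurableSet E := (measurable_hitCount S hW) (measurableSet_singleton k)
  let q : ℝ → ENNReal := fun z => uniformSphere m
    {v | (fun i => sliceHeight m (sphereInner (y i) x) z (sphereInner (π (y i)) v)) ∈ E}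
  let F : ℝ → ENNReal := fun z => ENNReal.ofReal (sliceDensity (m + 1) z) * q z
  have e1 : uniformSphere (m + 1) {u | localHeight n a x u ∈ J ∧
      hitCount S I (fun i => localHeight n a (y i) u) = k} = ∫⁻ z in A, F z := hπ _ y A E hA hE
  -- Translating the height by `s / n` brings the shifted event back to the window `A`, so both
  -- probabilities are integrals over the same set and can be compared pointwise.
  have e2 : uniformSphere (m + 1) {u | localHeight n a x u + s ∈ J ∧
      hitCount S I (fun i => localHeight n a (y i) u) = k} = ∫⁻ z in A, F (z - s / n) := by
    have h1 : {u | localHeight n a x u + s ∈ J ∧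
        hitCount S I (fun i => localHeight n a (y i) u) = k} =
        {u | √(m + 1 : ℕ) * sphereInner x u ∈ A' ∧
          (fun i => √(m + 1 : ℕ) * sphereInner (y i) u) ∈ E} := by
      ext u
      have h2 : localHeight n a x u + s
          = n * (√(m + 1 : ℕ) * sphereInner x u + s / n - a) := by
        rw [localHeight]; field_simp; ring
      simp only [Set.mem_ofPred_eq, h2]
      rfl
    rw [h1, hπ _ y A' E hA' hE]
    have h3 := lintegral_sub_right_eq_self (μ := volume) (A'.indicator F) (s / n)
    rw [lintegral_indicator hA'] at h3
    refine h3.symm.trans ?_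
    rw [← lintegral_indicator hA]
    refine lintegral_congr fun z => ?_
    by_cases hz : z ∈ A
    · have hz' : z - s / n ∈ A' := by
        change z - s / n + s / n ∈ A; rwa [sub_add_cancel]
      rw [Set.indicator_of_mem hz, Set.indicator_of_mem hz']
    · have hz' : z - s / n ∉ A' := by
        change ¬ (z - s / n + s / n ∈ A); rwa [sub_add_cancel]
      rw [Set.indicator_of_notMem hz, Set.indicator_of_notMem hz']
  have hpt : ∀ z ∈ A, F z ≤ F (z - s / n) + ENNReal.ofReal (2 * θ) := by
    intro z hz
    have hza : |z - a| ≤ R / n := abs_sub_le_of_mem_heightWindow hn.ne' hJR hz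
    have hzz : |z - (z - s / n)| ≤ |s| / n := by
      rw [sub_sub_cancel, abs_div, abs_of_pos hn']
    have hza' : |z - s / n - a| ≤ (R + |s|) / n := by
      rw [add_div]
      calc |z - s / n - a| = |(z - a) - s / n| := by ring_nf
        _ ≤ |z - a| + |s / n| := abs_sub _ _
        _ ≤ _ := by rw [abs_div, abs_of_pos hn']; linarith
    have hle : (R + |s|) / n ≤ R + |s| := div_le_self (by positivity) hn1
    have hza2 : |z - a| ≤ (R + |s|) / n := hza.trans (by gcongr; linarith [abs_nonneg s])
    have hq := hfib (fun i => π (y i)) (fun i => sphereInner (y i) x) S hS z (z - s / n)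
      (hza2.trans hle) (hza'.trans hle) hzz k
    have hq' : q z ≤ q (z - s / n) + ENNReal.ofReal θ := hq
    have hq1 : q z ≤ 1 := prob_le_one
    have hd1 := abs_lt.1 (hf z (hza2.trans_lt hnδ))
    have hd2 := abs_lt.1 (hf (z - s / n) (hza'.trans_lt hnδ))
    have hd3 : ENNReal.ofReal (sliceDensity (m + 1) z)
        ≤ ENNReal.ofReal (sliceDensity (m + 1) (z - s / n)) + ENNReal.ofReal θ := by
      rw [← ENNReal.ofReal_add (sliceDensity_nonneg _ _) hθ.le]
      exact ENNReal.ofReal_le_ofReal (by linarith)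
    have hd4 : ENNReal.ofReal (sliceDensity (m + 1) (z - s / n)) ≤ 1 :=
      ENNReal.ofReal_le_one.2 (hf1 _)
    calc F z ≤ (ENNReal.ofReal (sliceDensity (m + 1) (z - s / n)) + ENNReal.ofReal θ) * q z := by
          exact mul_le_mul' hd3 le_rfl
      _ = ENNReal.ofReal (sliceDensity (m + 1) (z - s / n)) * q z + ENNReal.ofReal θ * q z := by
          rw [add_mul]
      _ ≤ ENNReal.ofReal (sliceDensity (m + 1) (z - s / n)) * (q (z - s / n) + ENNReal.ofReal θ)
          + ENNReal.ofReal θ * 1 := by gcongr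
      _ = F (z - s / n) + (ENNReal.ofReal (sliceDensity (m + 1) (z - s / n)) * ENNReal.ofReal θ
          + ENNReal.ofReal θ) := by rw [mul_add, mul_one, add_assoc]
      _ ≤ F (z - s / n) + (1 * ENNReal.ofReal θ + ENNReal.ofReal θ) := by gcongr
      _ = _ := by
          rw [one_mul, ← ENNReal.ofReal_add hθ.le hθ.le]; congr 2; ring
  have hint : ∫⁻ z in A, F z ≤ (∫⁻ z in A, F (z - s / n)) + ENNReal.ofReal (2 * θ) * volume A := by
    refine (setLIntegral_mono' hA hpt).trans ?_
    rw [lintegral_add_right _ measurable_const, setLIntegral_const]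
  rw [← e1, ← e2, volume_heightWindow hn.ne' a hJ] at hint
  have hint' := ENNReal.toReal_mono (by finiteness) hint
  rw [ENNReal.toReal_add (by finiteness) (by finiteness)] at hint'
  simp only [ENNReal.toReal_mul, ENNReal.toReal_ofReal (by positivity : 0 ≤ 2 * θ),
    ENNReal.toReal_ofReal (by positivity : 0 ≤ (n : ℝ)⁻¹)] at hint'
  have := mul_le_mul_of_nonneg_left hint' hn'.le
  rw [mul_add] at this
  refine this.trans (add_le_add le_rfl ?_)
  calc n * (2 * θ * ((n : ℝ)⁻¹ * V)) = 2 * θ * V := by field_simp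
    _ ≤ η := hθη

/-! ### A second moment bound for averages -/

/-- A weak law of large numbers, tested on an event. -/
theorem abs_mean_setIntegral_sub_le {Ω : Type*} [MeasurableSpace Ω] (μ : Measure Ω)
    [IsProbabilityMeasure μ] {L : ℕ} (hL : 0 < L) {X : Fin L → Ω → ℝ} (hX : ∀ r, MemLp (X r) 2 μ)
    (E : Set Ω) {r θ η : ℝ} (hr : 0 ≤ r) (hη : 0 < η)
    (h1 : ∀ i, r - θ ≤ ∫ ω, X i ω ∂μ)
    (h2 : ∀ i j, ∫ ω, X i ω * X j ω ∂μ ≤ r ^ 2 + (if i = j then r else 0) + θ) :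
    |(L : ℝ)⁻¹ * ∑ i, ∫ ω in E, X i ω ∂μ - r * μ.real E|
      ≤ η / 2 + (r / L + θ * (1 + 2 * r)) / (2 * η) := by
  have hL' : (0 : ℝ) < L := by exact_mod_cast hL
  have hint : ∀ i, Integrable (X i) μ := fun i => (hX i).integrable one_le_two
  have hint2 : ∀ i j, Integrable (fun ω => X i ω * X j ω) μ := fun i j =>
    (hX i).integrable_mul (hX j)
  let Y : Ω → ℝ := fun ω => (L : ℝ)⁻¹ * ∑ i, X i ω - r
  have hY : MemLp Y 2 μ :=
    ((memLp_finsetSum _ fun i _ => hX i).const_mul _).sub (memLp_const r)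
  have hYi : Integrable Y μ := hY.integrable one_le_two
  have hYE : (L : ℝ)⁻¹ * ∑ i, ∫ ω in E, X i ω ∂μ - r * μ.real E = ∫ ω in E, Y ω ∂μ := by
    simp only [Y]
    rw [integral_sub ((integrable_finsetSum _ fun i _ => (hint i).integrableOn).const_mul _)
      (integrable_const _), integral_const_mul, integral_finsetSum _ fun i _ =>
      (hint i).integrableOn, setIntegral_const, smul_eq_mul, mul_comm r]
  -- Expanding the square gives at most `(r² + θ + r / L) - 2 r (r - θ) + r²`. Lower bounds on means
  -- and upper bounds on products suffice.
  have hY2 : ∫ ω, Y ω ^ 2 ∂μ ≤ r / L + θ * (1 + 2 * r) := by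
    have e1 : ∀ ω, Y ω ^ 2 = (L : ℝ)⁻¹ ^ 2 * ∑ i, ∑ j, X i ω * X j ω
        - 2 * r * (L : ℝ)⁻¹ * ∑ i, X i ω + r ^ 2 := fun ω => by
      simp only [Y]
      rw [← Finset.sum_mul_sum]; ring
    have i1 : Integrable (fun ω => (L : ℝ)⁻¹ ^ 2 * ∑ i, ∑ j, X i ω * X j ω) μ :=
      (integrable_finsetSum _ fun i _ => integrable_finsetSum _ fun j _ => hint2 i j).const_mul _
    have i2 : Integrable (fun ω => 2 * r * (L : ℝ)⁻¹ * ∑ i, X i ω) μ :=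
      (integrable_finsetSum _ fun i _ => hint i).const_mul _
    have i3 : Integrable (fun ω => (L : ℝ)⁻¹ ^ 2 * ∑ i, ∑ j, X i ω * X j ω
        - 2 * r * (L : ℝ)⁻¹ * ∑ i, X i ω) μ := i1.sub i2
    simp only [e1]
    rw [integral_add i3 (integrable_const _), integral_sub i1 i2, integral_const_mul,
      integral_const_mul, integral_finsetSum _ fun i _ => hint i,
      integral_finsetSum _ fun i _ => integrable_finsetSum _ fun j _ => hint2 i j]
    simp only [integral_finsetSum _ fun j _ => hint2 _ j, integral_const, probReal_univ, one_smul]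
    have s1 : ∑ i : Fin L, (r - θ) ≤ ∑ i, ∫ ω, X i ω ∂μ := Finset.sum_le_sum fun i _ => h1 i
    have s2 : ∑ i, ∑ j, ∫ ω, X i ω * X j ω ∂μ
        ≤ ∑ i : Fin L, ∑ j : Fin L, (r ^ 2 + (if i = j then r else 0) + θ) :=
      Finset.sum_le_sum fun i _ => Finset.sum_le_sum fun j _ => h2 i j
    have s3 : ∑ i : Fin L, ∑ j : Fin L, (r ^ 2 + (if i = j then r else 0) + θ)
        = L ^ 2 * (r ^ 2 + θ) + L * r := by
      simp only [Finset.sum_add_distrib, Finset.sum_ite_eq, Finset.mem_univ, if_true,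
        Finset.sum_const, Finset.card_univ, Fintype.card_fin, nsmul_eq_mul]
      ring
    rw [s3] at s2
    rw [Finset.sum_const, Finset.card_univ, Fintype.card_fin, nsmul_eq_mul] at s1
    have t1 := mul_le_mul_of_nonneg_left s1 (by positivity : 0 ≤ 2 * r * (L : ℝ)⁻¹)
    have t2 := mul_le_mul_of_nonneg_left s2 (by positivity : 0 ≤ (L : ℝ)⁻¹ ^ 2)
    have t3 : 2 * r * (L : ℝ)⁻¹ * (L * (r - θ)) = 2 * r * (r - θ) := by field_simp
    have t4 : (L : ℝ)⁻¹ ^ 2 * (L ^ 2 * (r ^ 2 + θ) + L * r) = r ^ 2 + θ + r / L := by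
      field_simp
    rw [t3] at t1
    rw [t4] at t2
    linarith
  rw [hYE]
  calc |∫ ω in E, Y ω ∂μ| ≤ ∫ ω in E, |Y ω| ∂μ := abs_integral_le_integral_abs
    _ ≤ ∫ ω, |Y ω| ∂μ := setIntegral_le_integral hYi.abs (ae_of_all _ fun ω => abs_nonneg _)
    -- The inequality `|Y| ≤ η / 2 + Y² / (2 η)` replaces Cauchy–Schwarz.
    _ ≤ ∫ ω, (η / 2 + (2 * η)⁻¹ * Y ω ^ 2) ∂μ := by
        refine integral_mono hYi.abs ((integrable_const _).add (hY.integrable_sq.const_mul _))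
          fun ω => ?_
        simp only
        rw [← sq_abs (Y ω)]
        have : η / 2 + (2 * η)⁻¹ * |Y ω| ^ 2 - |Y ω| = (2 * η)⁻¹ * (|Y ω| - η) ^ 2 := by
          field_simp; ring
        have h3 : 0 ≤ (2 * η)⁻¹ * (|Y ω| - η) ^ 2 := by positivity
        linarith
    _ = η / 2 + (2 * η)⁻¹ * ∫ ω, Y ω ^ 2 ∂μ := by
        rw [integral_add (integrable_const _) (hY.integrable_sq.const_mul _), integral_const_mul]
        simp
    _ ≤ _ := by
        rw [div_eq_inv_mul (r / L + _)]
        gcongr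

/-! ### Counts of hits and their integrals -/

/-- The point process as a counting function of the points with local height in `J`. -/
noncomputable def hits {n d : ℕ} (a : ℝ) (x : Fin n → UnitSphere d) (J : Set ℝ)
    (u : UnitSphere d) : ℕ :=
  hitCount Finset.univ J fun j => localHeight n a (x j) u

theorem measurableSet_localHeight_mem (n : ℕ) {d : ℕ} (a : ℝ) (x : UnitSphere d) {J : Set ℝ}
    (hJ : MeasurableSet J) : MeasurableSet {u | localHeight n a x u ∈ J} :=
  measurable_localHeight n a x hJ

theorem measurable_hitCount_localHeight (n : ℕ) {d : ℕ} (a : ℝ) (x : Fin n → UnitSphere d)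
    (S : Finset (Fin n)) {J : Set ℝ} (hJ : MeasurableSet J) :
    Measurable fun u => hitCount S J fun j => localHeight n a (x j) u :=
  (measurable_hitCount S hJ).comp (measurable_pi_lambda _ fun j => measurable_localHeight n a (x j))

theorem measurable_hits {n d : ℕ} (a : ℝ) (x : Fin n → UnitSphere d) {J : Set ℝ}
    (hJ : MeasurableSet J) : Measurable (hits a x J) :=
  measurable_hitCount_localHeight n a x _ hJ

theorem projectionProcess_real_eq_hits {n d : ℕ} (a : ℝ) (x : Fin n → UnitSphere d) {J : Set ℝ}
    (hJ : MeasurableSet J) (u : UnitSphere d) :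
    (projectionProcess x a u).real J = hits a x J u := by
  classical
  rw [Measure.real, projectionProcess, Measure.finsetSum_apply,
    ENNReal.toReal_sum (fun j _ => measure_ne_top _ _), hits, hitCount]
  push_cast
  refine Finset.sum_congr rfl fun j _ => ?_
  rw [Measure.dirac_apply' _ hJ]
  by_cases h : localHeight n a (x j) u ∈ J
  · rw [Set.indicator_of_mem h, Set.indicator_of_mem (by exact h)]; simp
  · rw [Set.indicator_of_notMem h, Set.indicator_of_notMem (by exact h)]; simp

theorem hits_eq_sum_indicator {n d : ℕ} (a : ℝ) (x : Fin n → UnitSphere d) (J : Set ℝ)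
    (u : UnitSphere d) :
    (hits a x J u : ℝ)
      = ∑ j, ({u | localHeight n a (x j) u ∈ J} : Set _).indicator (fun _ => (1 : ℝ)) u := by
  rw [hits, hitCount]
  push_cast
  refine Finset.sum_congr rfl fun j _ => ?_
  by_cases h : localHeight n a (x j) u ∈ J
  · rw [Set.indicator_of_mem h, Set.indicator_of_mem (by exact h)]; simp
  · rw [Set.indicator_of_notMem h, Set.indicator_of_notMem (by exact h)]; simp

theorem memLp_hits {n d : ℕ} [NeZero d] (a : ℝ) (x : Fin n → UnitSphere d) {J : Set ℝ}
    (hJ : MeasurableSet J) : MemLp (fun u => (hits a x J u : ℝ)) 2 (uniformSphere d) := by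
  simp only [hits_eq_sum_indicator]
  exact memLp_finsetSum _ fun j _ =>
    memLp_indicator_const 2 (measurableSet_localHeight_mem n a (x j) hJ) _
      (Or.inr (measure_ne_top _ _))

theorem setIntegral_hits {n d : ℕ} [NeZero d] (a : ℝ) (x : Fin n → UnitSphere d) {J : Set ℝ}
    (hJ : MeasurableSet J) (E : Set (UnitSphere d)) :
    ∫ u in E, (hits a x J u : ℝ) ∂uniformSphere d
      = ∑ j, (uniformSphere d).real {u | localHeight n a (x j) u ∈ J ∧ u ∈ E} := by
  simp only [hits_eq_sum_indicator]
  have hm := fun j => measurableSet_localHeight_mem n a (x j) hJ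
  rw [integral_finsetSum _ fun j _ => (integrable_const _).indicator (hm j)]
  refine Finset.sum_congr rfl fun j _ => ?_
  rw [integral_indicator_const _ (hm j), smul_eq_mul, mul_one, measureReal_restrict_apply (hm j)]
  rfl

theorem integral_hits {n d : ℕ} [NeZero d] (a : ℝ) (x : Fin n → UnitSphere d) {J : Set ℝ}
    (hJ : MeasurableSet J) :
    ∫ u, (hits a x J u : ℝ) ∂uniformSphere d
      = ∑ j, (uniformSphere d).real {u | localHeight n a (x j) u ∈ J} := by
  have := setIntegral_hits a x hJ Set.univ
  simpa using this

theorem integral_hits_mul_hits {n d : ℕ} [NeZero d] (a : ℝ) (x : Fin n → UnitSphere d)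
    {J J' : Set ℝ} (hJ : MeasurableSet J) (hJ' : MeasurableSet J') :
    ∫ u, (hits a x J u : ℝ) * hits a x J' u ∂uniformSphere d
      = ∑ i, ∑ j, (uniformSphere d).real
        {u | localHeight n a (x i) u ∈ J ∧ localHeight n a (x j) u ∈ J'} := by
  have hm := fun j => measurableSet_localHeight_mem n a (x j) hJ
  have hm' := fun j => measurableSet_localHeight_mem n a (x j) hJ'
  simp only [hits_eq_sum_indicator, Finset.sum_mul_sum, ← Set.inter_indicator_mul, one_mul]
  have hi : ∀ i j, Integrable (fun u => ({u | localHeight n a (x i) u ∈ J} ∩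
      {u | localHeight n a (x j) u ∈ J'}).indicator (fun _ => (1 : ℝ)) u) (uniformSphere d) :=
    fun i j => (integrable_const _).indicator ((hm i).inter (hm' j))
  rw [integral_finsetSum _ fun i _ => integrable_finsetSum _ fun j _ => hi i j]
  refine Finset.sum_congr rfl fun i _ => ?_
  rw [integral_finsetSum _ fun j _ => hi i j]
  refine Finset.sum_congr rfl fun j _ => ?_
  rw [integral_indicator_const _ ((hm i).inter (hm' j)), smul_eq_mul, mul_one]
  rfl

/-- The estimates concern spheres in dimension `m + 1`, whose slices live in dimension `m`. As `d →
∞`, the dimension `d` is eventually of this form with `m → ∞`. -/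
theorem Filter.Tendsto.eventually_prod_succ {ι : Type*} {l : Filter ι} {n d : ι → ℕ}
    (hn : Tendsto n l atTop) (hd : Tendsto d l atTop) {P : ℕ → ℕ → Prop}
    (h : ∀ᶠ p : ℕ × ℕ in atTop ×ˢ atTop, P p.1 (p.2 + 1)) : ∀ᶠ k in l, P (n k) (d k) := by
  have h1 : Tendsto (fun k => (n k, d k - 1)) l (atTop ×ˢ atTop) :=
    hn.prodMk ((tendsto_sub_atTop_nat 1).comp hd)
  filter_upwards [h1.eventually h, hd.eventually_ge_atTop 1] with k hk hk1
  simpa only [Nat.sub_add_cancel hk1] using hk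

/-! ### Almost orthogonal pairs and the remaining pairs -/

section

open scoped Classical in
/-- The points other than `x j` almost orthogonal to `x j`. -/
noncomputable def goodIndices {n d : ℕ} (x : Fin n → UnitSphere d) (ε : ℝ) (j : Fin n) :
    Finset (Fin n) :=
  {i | i ≠ j ∧ |sphereInner (x i) (x j)| < ε}

open scoped Classical in
/-- The points other than `x j` not almost orthogonal to `x j`. -/
noncomputable def badIndices {n d : ℕ} (x : Fin n → UnitSphere d) (ε : ℝ) (j : Fin n) :
    Finset (Fin n) :=
  {i | i ≠ j ∧ ε ≤ |sphereInner (x i) (x j)|}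

theorem sum_eq_add_good_add_bad {n d : ℕ} (x : Fin n → UnitSphere d) (ε : ℝ) (j : Fin n)
    {M : Type*} [AddCommMonoid M] (f : Fin n → M) :
    ∑ i, f i = f j + (∑ i ∈ goodIndices x ε j, f i + ∑ i ∈ badIndices x ε j, f i) := by
  classical
  rw [← Finset.add_sum_erase _ _ (Finset.mem_univ j)]
  congr 1
  rw [← Finset.sum_filter_add_sum_filter_not _ fun i => |sphereInner (x i) (x j)| < ε]
  congr 1
  · refine Finset.sum_congr ?_ fun _ _ => rfl
    ext i; simp [goodIndices]
  · refine Finset.sum_congr ?_ fun _ _ => rfl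
    ext i; simp [badIndices]

theorem sum_badIndices_pairWeight {n d : ℕ} (x : Fin n → UnitSphere d) (ε : ℝ) :
    ∑ j, ∑ i ∈ badIndices x ε j, pairWeight n (sphereInner (x j) (x i))
      = 2 * correlationSum x ε := by
  classical
  have h1 : correlationSum x ε = ∑ i, ∑ j, if i < j ∧ ε ≤ |sphereInner (x i) (x j)| then
      pairWeight n (sphereInner (x i) (x j)) else 0 := by
    rw [correlationSum, Finset.sum_filter, Fintype.sum_prod_type]
  have h2 : correlationSum x ε = ∑ j, ∑ i, if i < j ∧ ε ≤ |sphereInner (x i) (x j)| then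
      pairWeight n (sphereInner (x j) (x i)) else 0 := by
    rw [h1, Finset.sum_comm]
    simp only [sphereInner_comm]
  rw [two_mul]
  nth_rewrite 1 [h1]
  rw [h2, ← Finset.sum_add_distrib]
  refine Finset.sum_congr rfl fun j _ => ?_
  rw [badIndices, Finset.sum_filter, ← Finset.sum_add_distrib]
  refine Finset.sum_congr rfl fun i _ => ?_
  rw [sphereInner_comm (x i) (x j)]
  rcases lt_trichotomy i j with h | h | h
  · simp [h, h.ne, h.not_gt]
  · simp [h]
  · simp [h, h.ne', h.not_gt]

end

/-- The expected number of pairs of hits by points that are not almost orthogonal. -/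
noncomputable def badPairs {n d : ℕ} (a : ℝ) (x : Fin n → UnitSphere d) (ε : ℝ) (J J' : Set ℝ) :
    ℝ :=
  ∑ j, ∑ i ∈ badIndices x ε j, (uniformSphere d).real
    {u | localHeight n a (x j) u ∈ J ∧ localHeight n a (x i) u ∈ J'}

/-- A union bound over the exceptional events. Keeping the intersection with `A` matters: with `A` a
hit by `x_j` and `T i` a hit by `x_i`, the error is a sum of pair probabilities. -/
theorem abs_measureReal_inter_sub_le {Ω κ : Type*} [MeasurableSpace Ω] (μ : Measure Ω)
    [IsFiniteMeasure μ] {A B C : Set Ω} (S : Finset κ) (T : κ → Set Ω)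
    (h : ∀ ω ∈ A, (∀ i ∈ S, ω ∉ T i) → (ω ∈ B ↔ ω ∈ C)) :
    |μ.real (A ∩ B) - μ.real (A ∩ C)| ≤ ∑ i ∈ S, μ.real (A ∩ T i) := by
  have key : ∀ {B C : Set Ω}, (∀ ω ∈ A, (∀ i ∈ S, ω ∉ T i) → (ω ∈ B ↔ ω ∈ C)) →
      μ.real (A ∩ B) ≤ μ.real (A ∩ C) + ∑ i ∈ S, μ.real (A ∩ T i) := by
    intro B C h
    have hsub : A ∩ B ⊆ A ∩ C ∪ ⋃ i ∈ S, A ∩ T i := by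
      rintro ω ⟨hA, hB⟩
      by_cases hT : ∀ i ∈ S, ω ∉ T i
      · exact Or.inl ⟨hA, (h ω hA hT).1 hB⟩
      · push Not at hT
        obtain ⟨i, hi, hT⟩ := hT
        refine Or.inr ?_
        simp only [Set.mem_iUnion]
        exact ⟨i, hi, hA, hT⟩
    exact (measureReal_mono hsub).trans ((measureReal_union_le _ _).trans
      (add_le_add le_rfl (measureReal_biUnion_finset_le _ _)))
  rw [abs_le]
  have h1 := key h
  have h2 := key (B := C) (C := B) fun ω hA hT => (h ω hA hT).symm
  constructor <;> linarith

/-- This is where the correlation hypothesis enters: each pair costs at most `C / n²` times its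
weight, and the ordered sum of the weights is twice `correlationSum`, which is `o(n²)`. -/
theorem tendsto_badPairs {ι : Type*} {l : Filter ι} {n d : ι → ℕ} (hn : Tendsto n l atTop)
    (hd : Tendsto d l atTop) {x : (k : ι) → Fin (n k) → UnitSphere (d k)} (a : ℝ)
    (hx : ∀ ε : ℝ, 0 < ε →
      (fun k => correlationSum (x k) ε) =o[l] (fun k => (n k : ℝ) ^ 2))
    {ε : ℝ} (hε : 0 < ε) {J J' : Set ℝ} (hJ : MeasurableSet J) (hJ' : MeasurableSet J')
    (hJb : Bornology.IsBounded J) (hJb' : Bornology.IsBounded J') :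
    Tendsto (fun k => badPairs a (x k) ε J J') l (nhds 0) := by
  obtain ⟨C, hC, h⟩ := exists_forall_pair_le_pairWeight a hJ hJ' hJb hJb'
  have h' := hn.eventually_prod_succ hd (P := fun n d => ∀ x y : UnitSphere d,
    (n : ℝ) ^ 2 * (uniformSphere d).real {u | localHeight n a x u ∈ J ∧ localHeight n a y u ∈ J'}
      ≤ C * pairWeight n (sphereInner x y)) h
  have hlim := ((hx ε hε).tendsto_div_nhds_zero).const_mul (2 * C)
  rw [mul_zero] at hlim
  refine tendsto_of_tendsto_of_tendsto_of_le_of_le' tendsto_const_nhds hlim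
    (.of_forall fun k => Finset.sum_nonneg fun j _ => Finset.sum_nonneg fun i _ =>
      measureReal_nonneg) ?_
  filter_upwards [h', hn.eventually_gt_atTop 0] with k hk hnk
  have hnk' : (0 : ℝ) < n k := by exact_mod_cast hnk
  rw [← mul_div_assoc, le_div_iff₀ (by positivity), badPairs, mul_comm, Finset.mul_sum]
  calc _ ≤ ∑ j, ∑ i ∈ badIndices (x k) ε j, C * pairWeight (n k) (sphereInner (x k j) (x k i)) := by
        refine Finset.sum_le_sum fun j _ => ?_
        rw [Finset.mul_sum]
        exact Finset.sum_le_sum fun i _ => hk _ _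
    _ = 2 * C * correlationSum (x k) ε := by
        simp only [← Finset.mul_sum]
        rw [sum_badIndices_pairWeight]; ring

/-! ### First and second moments of the counts -/

theorem tendsto_first_moment {ι : Type*} {l : Filter ι} {n d : ι → ℕ} (hn : Tendsto n l atTop)
    (hd : Tendsto d l atTop) {x : (k : ι) → Fin (n k) → UnitSphere (d k)} (a : ℝ)
    {J : Set ℝ} (hJ : MeasurableSet J) (hJb : Bornology.IsBounded J) :
    Tendsto (fun k => ∑ j, (uniformSphere (d k)).real {u | localHeight (n k) a (x k j) u ∈ J}) l
      (nhds (gaussianPDFReal 0 1 a * volume.real J)) := by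
  rw [Metric.tendsto_nhds]
  intro η hη
  have h := hn.eventually_prod_succ hd (P := fun n d => ∀ x : UnitSphere d,
    |n * (uniformSphere d).real {u | localHeight n a x u ∈ J}
        - gaussianPDFReal 0 1 a * volume.real J| ≤ η / 2)
    (eventually_localHeight_mem a hJ hJb (half_pos hη))
  filter_upwards [h, hn.eventually_gt_atTop 0] with k hk hnk
  have hnk' : (0 : ℝ) < n k := by exact_mod_cast hnk
  rw [Real.dist_eq]
  set c := gaussianPDFReal 0 1 a * volume.real J
  have e : ∑ j, (uniformSphere (d k)).real {u | localHeight (n k) a (x k j) u ∈ J} - c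
      = ∑ j, (n k : ℝ)⁻¹ * (n k * (uniformSphere (d k)).real
        {u | localHeight (n k) a (x k j) u ∈ J} - c) := by
    simp only [mul_sub, Finset.sum_sub_distrib, Finset.sum_const, Finset.card_univ,
      Fintype.card_fin, nsmul_eq_mul, inv_mul_cancel_left₀ hnk'.ne', mul_inv_cancel_left₀ hnk'.ne']
  rw [e]
  calc _ ≤ ∑ j : Fin (n k), (n k : ℝ)⁻¹ * (η / 2) := by
        refine (Finset.abs_sum_le_sum_abs _ _).trans (Finset.sum_le_sum fun j _ => ?_)
        rw [abs_mul, abs_of_pos (by positivity : 0 < (n k : ℝ)⁻¹)]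
        exact mul_le_mul_of_nonneg_left (hk _) (by positivity)
    _ = η / 2 := by
        rw [Finset.sum_const, Finset.card_univ, Fintype.card_fin, nsmul_eq_mul,
          mul_inv_cancel_left₀ hnk'.ne']
    _ < η := half_lt_self hη

/-- The diagonal gives `φ(a) mes (J ∩ J')`, almost orthogonal pairs at most the product of the means
up to `o(1)`, and the other pairs `o(1)`. An upper bound is enough, since it serves to bound a
variance. -/
theorem eventually_second_moment_le {ι : Type*} {l : Filter ι} {n d : ι → ℕ} [∀ k, NeZero (d k)]
    (hn : Tendsto n l atTop)
    (hd : Tendsto d l atTop) {x : (k : ι) → Fin (n k) → UnitSphere (d k)} (a : ℝ)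
    (hx : ∀ ε : ℝ, 0 < ε →
      (fun k => correlationSum (x k) ε) =o[l] (fun k => (n k : ℝ) ^ 2))
    {J J' : Set ℝ} (hJ : MeasurableSet J) (hJ' : MeasurableSet J')
    (hJb : Bornology.IsBounded J) (hJb' : Bornology.IsBounded J') {η : ℝ} (hη : 0 < η) :
    ∀ᶠ k in l, ∑ i, ∑ j, (uniformSphere (d k)).real {u | localHeight (n k) a (x k i) u ∈ J ∧
        localHeight (n k) a (x k j) u ∈ J'}
      ≤ gaussianPDFReal 0 1 a ^ 2 * (volume.real J * volume.real J')
        + gaussianPDFReal 0 1 a * volume.real (J ∩ J') + η := by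
  obtain ⟨ε, hε, h⟩ := exists_forall_pair_le a hJ hJ' hJb hJb' (by positivity : 0 < η / 3)
  set c := gaussianPDFReal 0 1 a ^ 2 * (volume.real J * volume.real J') with hc
  have hc0 : 0 ≤ c := by positivity
  have h' := hn.eventually_prod_succ hd (P := fun n d => ∀ x y : UnitSphere d,
    |sphereInner x y| < ε → (n : ℝ) ^ 2 * (uniformSphere d).real
      {u | localHeight n a x u ∈ J ∧ localHeight n a y u ∈ J'} ≤ c + η / 3) h
  have hdiag := (tendsto_first_moment hn hd (x := x) a (hJ.inter hJ')
    (hJb.subset Set.inter_subset_left)).eventually_lt_const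
      (lt_add_of_pos_right _ (by positivity : 0 < η / 3))
  have hbad := (tendsto_badPairs hn hd a hx hε hJ hJ' hJb hJb').eventually_lt_const
    (by positivity : 0 < η / 3)
  filter_upwards [h', hdiag, hbad, hn.eventually_gt_atTop 0] with k hk hdiag hbad hnk
  have hnk' : (0 : ℝ) < n k := by exact_mod_cast hnk
  simp only [fun i => sum_eq_add_good_add_bad (x k) ε i fun j => (uniformSphere (d k)).real
    {u | localHeight (n k) a (x k i) u ∈ J ∧ localHeight (n k) a (x k j) u ∈ J'}]
  rw [Finset.sum_add_distrib, Finset.sum_add_distrib]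
  change _ + (_ + badPairs a (x k) ε J J') ≤ _
  have hgood : ∑ i, ∑ j ∈ goodIndices (x k) ε i, (uniformSphere (d k)).real
      {u | localHeight (n k) a (x k i) u ∈ J ∧ localHeight (n k) a (x k j) u ∈ J'} ≤ c + η / 3 := by
    calc _ ≤ ∑ i : Fin (n k), ∑ j : Fin (n k), (c + η / 3) / (n k) ^ 2 := by
          refine Finset.sum_le_sum fun i _ => ?_
          refine (Finset.sum_le_sum fun j hj => ?_).trans
            (Finset.sum_le_sum_of_subset_of_nonneg (Finset.subset_univ (goodIndices (x k) ε i))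
              fun _ _ _ => by positivity)
          rw [le_div_iff₀ (by positivity), mul_comm]
          refine hk _ _ ?_
          rw [sphereInner_comm]
          exact (Finset.mem_filter.1 hj).2.2
      _ = c + η / 3 := by
          simp only [Finset.sum_const, Finset.card_univ, Fintype.card_fin, nsmul_eq_mul]
          field_simp
  change ∑ i, (uniformSphere (d k)).real {u | localHeight (n k) a (x k i) u ∈ J ∩ J'} + _ ≤ _
  linarith

/-! ### The asymptotic Poisson recursion -/

/-- For each `j`, delete `j` and its bad neighbours from the count, shift `t_j` by `s`, then put
them back. If `t_j ∈ I`, the point `j` itself accounts for one hit; if `t_j + s ∈ I`, then `t_j ∉ I`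
and it accounts for none. So `m + 1` becomes `m`. -/
theorem tendsto_succ_mul_sub_sum {ι : Type*} {l : Filter ι} {n d : ι → ℕ} [∀ k, NeZero (d k)]
    (hn : Tendsto n l atTop)
    (hd : Tendsto d l atTop) {x : (k : ι) → Fin (n k) → UnitSphere (d k)} (a : ℝ)
    (hx : ∀ ε : ℝ, 0 < ε →
      (fun k => correlationSum (x k) ε) =o[l] (fun k => (n k : ℝ) ^ 2))
    {I : Set ℝ} (hI : MeasurableSet I) (hIb : Bornology.IsBounded I) {s : ℝ}
    (hs : ∀ t ∈ I, t + s ∉ I) (m : ℕ) :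
    Tendsto (fun k => (m + 1) * (uniformSphere (d k)).real {u | hits a (x k) I u = m + 1}
      - ∑ j, (uniformSphere (d k)).real
        {u | localHeight (n k) a (x k j) u + s ∈ I ∧ hits a (x k) I u = m}) l (nhds 0) := by
  set J : Set ℝ := {t | t + s ∈ I} with hJdef
  have hJ : MeasurableSet J := (by fun_prop : Measurable fun t : ℝ => t + s) hI
  have hJb : Bornology.IsBounded J := by
    obtain ⟨R, -, hR⟩ := exists_abs_le_of_isBounded hIb
    refine isBounded_iff_forall_norm_le.2 ⟨R + |s|, fun t ht => ?_⟩
    have h1 := hR _ ht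
    have h2 := abs_sub (t + s) s
    rw [add_sub_cancel_right] at h2
    rw [Real.norm_eq_abs]; linarith
  rw [Metric.tendsto_nhds]
  intro η hη
  -- The shift estimate is one-sided. Using it for `I` with `s` and for the translate `J` with `-s`
  -- bounds the difference from both sides.
  obtain ⟨ε₁, hε₁, h₁⟩ := exists_forall_shift_le a hI hIb hI hIb s (by positivity : 0 < η / 4)
  obtain ⟨ε₂, hε₂, h₂⟩ := exists_forall_shift_le a hI hIb hJ hJb (-s) (by positivity : 0 < η / 4)
  have h₁' := hn.eventually_prod_succ hd (P := fun n d => ∀ (x : UnitSphere d)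
      (y : Fin n → UnitSphere d) (S : Finset (Fin n)),
      (∀ i ∈ S, |sphereInner (y i) x| < ε₁) → ∀ k,
      n * (uniformSphere d).real {u | localHeight n a x u ∈ I ∧
          hitCount S I (fun i => localHeight n a (y i) u) = k}
        ≤ n * (uniformSphere d).real {u | localHeight n a x u + s ∈ I ∧
          hitCount S I (fun i => localHeight n a (y i) u) = k} + η / 4) h₁
  have h₂' := hn.eventually_prod_succ hd (P := fun n d => ∀ (x : UnitSphere d)
      (y : Fin n → UnitSphere d) (S : Finset (Fin n)),
      (∀ i ∈ S, |sphereInner (y i) x| < ε₂) → ∀ k,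
      n * (uniformSphere d).real {u | localHeight n a x u ∈ J ∧
          hitCount S I (fun i => localHeight n a (y i) u) = k}
        ≤ n * (uniformSphere d).real {u | localHeight n a x u + -s ∈ J ∧
          hitCount S I (fun i => localHeight n a (y i) u) = k} + η / 4) h₂
  set ε := min ε₁ ε₂
  have hε : 0 < ε := lt_min hε₁ hε₂
  have hb₁ := (tendsto_badPairs hn hd a hx hε hI hI hIb hIb).eventually_lt_const
    (by positivity : 0 < η / 4)
  have hb₂ := (tendsto_badPairs hn hd a hx hε hJ hI hJb hIb).eventually_lt_const
    (by positivity : 0 < η / 4)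
  filter_upwards [h₁', h₂', hb₁, hb₂, hn.eventually_gt_atTop 0] with k h₁ h₂ hb₁ hb₂ hnk
  have hnk' : (0 : ℝ) < n k := by exact_mod_cast hnk
  set μ := uniformSphere (d k)
  let t : Fin (n k) → UnitSphere (d k) → ℝ := fun j u => localHeight (n k) a (x k j) u
  let N : Fin (n k) → UnitSphere (d k) → ℕ := fun j u =>
    hitCount (goodIndices (x k) ε j) I fun i => t i u
  have hcount : ∀ j u, (∀ i ∈ badIndices (x k) ε j, t i u ∉ I) →
      hits a (x k) I u = I.indicator 1 (t j u) + N j u := by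
    intro j u hbad
    rw [hits, hitCount, sum_eq_add_good_add_bad (x k) ε j,
      Finset.sum_eq_zero (s := badIndices (x k) ε j)
      fun i hi => Set.indicator_of_notMem (hbad i hi) _, add_zero]
    rfl
  -- Integrate the count over the event where it equals `m + 1`, and expand it as a sum over the
  -- points.
  have e0 : (m + 1) * μ.real {u | hits a (x k) I u = m + 1}
      = ∑ j, μ.real ({u | t j u ∈ I} ∩ {u | hits a (x k) I u = m + 1}) := by
    have hE : MeasurableSet {u | hits a (x k) I u = m + 1} :=
      measurable_hits a (x k) hI (measurableSet_singleton _)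
    have h := setIntegral_hits a (x k) hI {u | hits a (x k) I u = m + 1}
    refine Eq.trans ?_ h
    rw [setIntegral_congr_fun (g := fun _ => (m + 1 : ℝ)) hE fun u hu => by
      have : hits a (x k) I u = m + 1 := hu
      simp [this]]
    rw [setIntegral_const, smul_eq_mul, mul_comm]
  have hstep1 : ∀ j, |μ.real ({u | t j u ∈ I} ∩ {u | hits a (x k) I u = m + 1})
      - μ.real ({u | t j u ∈ I} ∩ {u | N j u = m})|
      ≤ ∑ i ∈ badIndices (x k) ε j, μ.real {u | t j u ∈ I ∧ t i u ∈ I} := fun j =>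
    abs_measureReal_inter_sub_le μ _ (fun i => {u | t i u ∈ I}) fun u hu hbad => by
      have hu : t j u ∈ I := hu
      have h3 := hcount j u hbad
      rw [Set.indicator_of_mem hu] at h3
      simp only [Set.mem_ofPred_eq, h3, Pi.one_apply]
      omega
  have hstep2 : ∀ j, |μ.real ({u | t j u ∈ J} ∩ {u | hits a (x k) I u = m})
      - μ.real ({u | t j u ∈ J} ∩ {u | N j u = m})|
      ≤ ∑ i ∈ badIndices (x k) ε j, μ.real {u | t j u ∈ J ∧ t i u ∈ I} := fun j =>
    abs_measureReal_inter_sub_le μ _ (fun i => {u | t i u ∈ I}) fun u hu hbad => by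
      have h3 := hcount j u hbad
      rw [Set.indicator_of_notMem (fun h => hs _ h hu), zero_add] at h3
      simp only [Set.mem_ofPred_eq, h3]
  have hstep3 : ∀ j, |μ.real ({u | t j u ∈ I} ∩ {u | N j u = m})
      - μ.real ({u | t j u ∈ J} ∩ {u | N j u = m})| ≤ η / 4 / n k := by
    intro j
    have hg : ∀ i ∈ goodIndices (x k) ε j, |sphereInner (x k i) (x k j)| < ε := fun i hi =>
      (Finset.mem_filter.1 hi).2.2
    have h3 := h₁ (x k j) (x k) _ (fun i hi => (hg i hi).trans_le (min_le_left _ _)) m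
    have h4 := h₂ (x k j) (x k) _ (fun i hi => (hg i hi).trans_le (min_le_right _ _)) m
    simp only [hJdef, Set.mem_ofPred_eq, neg_add_cancel_right] at h4
    rw [← abs_of_pos hnk', le_div_iff₀ (abs_pos.2 hnk'.ne'), ← abs_mul, abs_le]
    change n k * μ.real ({u | t j u ∈ I} ∩ {u | N j u = m})
      ≤ n k * μ.real ({u | t j u ∈ J} ∩ {u | N j u = m}) + η / 4 at h3
    change n k * μ.real ({u | t j u ∈ J} ∩ {u | N j u = m})
      ≤ n k * μ.real ({u | t j u ∈ I} ∩ {u | N j u = m}) + η / 4 at h4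
    constructor <;> linarith
  have hsum3 : ∑ _j : Fin (n k), η / 4 / n k = η / 4 := by
    rw [Finset.sum_const, Finset.card_univ, Fintype.card_fin, nsmul_eq_mul]
    field_simp
  rw [Real.dist_eq, sub_zero, e0]
  change |_ - ∑ j, μ.real ({u | t j u ∈ J} ∩ {u | hits a (x k) I u = m})| < η
  rw [← Finset.sum_sub_distrib]
  calc _ ≤ ∑ j, (∑ i ∈ badIndices (x k) ε j, μ.real {u | t j u ∈ I ∧ t i u ∈ I}
        + ∑ i ∈ badIndices (x k) ε j, μ.real {u | t j u ∈ J ∧ t i u ∈ I} + η / 4 / n k) := by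
        refine (Finset.abs_sum_le_sum_abs _ _).trans (Finset.sum_le_sum fun j _ => ?_)
        have h3 := abs_le.1 (hstep1 j)
        have h4 := abs_le.1 (hstep2 j)
        have h5 := abs_le.1 (hstep3 j)
        rw [abs_le]
        constructor <;> linarith
    _ = badPairs a (x k) ε I I + badPairs a (x k) ε J I + η / 4 := by
        rw [Finset.sum_add_distrib, Finset.sum_add_distrib, hsum3]; rfl
    _ < η := by linarith

/-- The left term does not involve the shift, so the comparison may be averaged over many shifts.
The averaged count of the translates concentrates at `r`, even on the event that `m` points hit `I`.
-/
theorem tendsto_succ_mul_sub {ι : Type*} {l : Filter ι} {n d : ι → ℕ}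
    [∀ k, NeZero (d k)] (hn : Tendsto n l atTop) (hd : Tendsto d l atTop)
    {x : (k : ι) → Fin (n k) → UnitSphere (d k)} (a : ℝ)
    (hx : ∀ ε : ℝ, 0 < ε →
      (fun k => correlationSum (x k) ε) =o[l] (fun k => (n k : ℝ) ^ 2))
    {I : Set ℝ} (hI : MeasurableSet I) (hIb : Bornology.IsBounded I) (m : ℕ) :
    Tendsto (fun k => (m + 1) * (uniformSphere (d k)).real {u | hits a (x k) I u = m + 1}
      - gaussianPDFReal 0 1 a * volume.real I *
        (uniformSphere (d k)).real {u | hits a (x k) I u = m}) l (nhds 0) := by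
  set g := gaussianPDFReal 0 1 a
  have hg : 0 ≤ g := gaussianPDFReal_nonneg _ _ _
  set r := g * volume.real I with hrdef
  have hr : 0 ≤ r := mul_nonneg hg measureReal_nonneg
  rw [Metric.tendsto_nhds]
  intro η hη
  -- With these choices the law of large numbers at level `η / 2` costs less than `η / 4 + (η² / 8 +
  -- η² / 8) / η = η / 2`; the averaged comparison takes the other half.
  obtain ⟨L, hL, hLη⟩ : ∃ L : ℕ, 0 < L ∧ r / L < η ^ 2 / 8 :=
    ((eventually_gt_atTop 0).and (eventually_div_natCast_lt r (by positivity))).exists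
  set θ := η ^ 2 / (8 * (1 + 2 * r)) with hθdef
  have hθ : 0 < θ := by positivity
  have hθr : θ * (1 + 2 * r) = η ^ 2 / 8 := by rw [hθdef]; field_simp
  obtain ⟨R, hR, hIR⟩ := exists_abs_le_of_isBounded hIb
  -- As `I ⊆ [-R, R]`, shifts by positive multiples of `2 R + 1` make the translates disjoint from
  -- each other; starting at `i + 1` rather than `i` also makes them disjoint from `I`.
  let s : Fin L → ℝ := fun i => (2 * R + 1) * (i + 1)
  let J : Fin L → Set ℝ := fun i => {t | t + s i ∈ I}
  have hJ : ∀ i, MeasurableSet (J i) := fun i =>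
    (by fun_prop : Measurable fun t : ℝ => t + s i) hI
  have hJb : ∀ i, Bornology.IsBounded (J i) := fun i => by
    refine isBounded_iff_forall_norm_le.2 ⟨R + |s i|, fun t ht => ?_⟩
    have h1 := hIR _ ht
    have h2 := abs_sub (t + s i) (s i)
    rw [add_sub_cancel_right] at h2
    rw [Real.norm_eq_abs]; linarith
  have hJv : ∀ i, volume.real (J i) = volume.real I := fun i => by
    rw [Measure.real, Measure.real]
    congr 1
    exact measure_preimage_add_right volume (s i) I
  have hsI : ∀ i, ∀ t ∈ I, t + s i ∉ I := fun i t ht ht' => by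
    have h1 := abs_le.1 (hIR _ ht)
    have h2 := abs_le.1 (hIR _ ht')
    have h3 : 0 ≤ (2 * R + 1) * (i : ℝ) := by positivity
    simp only [s] at h2
    linarith
  have hdisj : ∀ i j, i ≠ j → J i ∩ J j = ∅ := by
    have key : ∀ i j : Fin L, i < j → J i ∩ J j = ∅ := fun i j hij => by
      refine Set.eq_empty_of_forall_notMem fun t ht => ?_
      have h1 := abs_le.1 (hIR _ ht.1)
      have h2 := abs_le.1 (hIR _ ht.2)
      have h3 : (i : ℝ) + 1 ≤ j := by exact_mod_cast hij
      simp only [s] at h1 h2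
      nlinarith
    intro i j hij
    rcases lt_or_gt_of_ne hij with h | h
    · exact key i j h
    · rw [Set.inter_comm]; exact key j i h
  have hdiff : Tendsto (fun k => (L : ℝ)⁻¹ * ∑ i, ((m + 1) * (uniformSphere (d k)).real
      {u | hits a (x k) I u = m + 1} - ∑ j, (uniformSphere (d k)).real
        {u | localHeight (n k) a (x k j) u + s i ∈ I ∧ hits a (x k) I u = m})) l (nhds 0) := by
    have h1 := (tendsto_finsetSum Finset.univ fun i _ =>
      tendsto_succ_mul_sub_sum hn hd a hx hI hIb (hsI i) m).const_mul (L : ℝ)⁻¹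
    simpa using h1
  have hfirst : ∀ᶠ k in l, ∀ i, r - θ ≤ ∑ j, (uniformSphere (d k)).real
      {u | localHeight (n k) a (x k j) u ∈ J i} := by
    rw [eventually_all]
    intro i
    have h1 := tendsto_first_moment hn hd (x := x) a (hJ i) (hJb i)
    rw [hJv] at h1
    exact (h1.eventually_const_lt (sub_lt_self r hθ)).mono fun _ h => h.le
  have hsecond : ∀ᶠ k in l, ∀ i i', ∑ j, ∑ j', (uniformSphere (d k)).real
      {u | localHeight (n k) a (x k j) u ∈ J i ∧ localHeight (n k) a (x k j') u ∈ J i'}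
      ≤ r ^ 2 + (if i = i' then r else 0) + θ := by
    rw [eventually_all]
    intro i
    rw [eventually_all]
    intro i'
    refine (eventually_second_moment_le hn hd a hx (hJ i) (hJ i') (hJb i) (hJb i') hθ).mono
      fun k hk => hk.trans (le_of_eq ?_)
    rw [hJv, hJv, hrdef]
    by_cases h : i = i'
    · subst h; rw [Set.inter_self, hJv, if_pos rfl]; ring
    · rw [hdisj i i' h, if_neg h]; simp; ring
  filter_upwards [hfirst, hsecond, (Metric.tendsto_nhds.1 hdiff) (η / 2) (half_pos hη)]
    with k h1 h2 h3
  rw [Real.dist_eq, sub_zero] at h3 ⊢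
  set μ := uniformSphere (d k)
  have h4 := abs_mean_setIntegral_sub_le μ hL (X := fun i u => (hits a (x k) (J i) u : ℝ))
    (fun i => memLp_hits a (x k) (hJ i)) {u | hits a (x k) I u = m} hr (half_pos hη)
    (fun i => (h1 i).trans_eq (integral_hits a (x k) (hJ i)).symm)
    (fun i i' => (integral_hits_mul_hits a (x k) (hJ i) (hJ i')).trans_le (h2 i i'))
  have hint : ∀ i, ∫ u in {u | hits a (x k) I u = m}, (hits a (x k) (J i) u : ℝ) ∂μ
      = ∑ j, μ.real {u | localHeight (n k) a (x k j) u + s i ∈ I ∧ hits a (x k) I u = m} :=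
    fun i => setIntegral_hits a (x k) (hJ i) _
  rw [Finset.sum_congr rfl fun i _ => hint i] at h4
  have h5 : η / 2 / 2 + (r / L + θ * (1 + 2 * r)) / (2 * (η / 2)) < η / 2 := by
    rw [hθr]
    have : (r / L + η ^ 2 / 8) / (2 * (η / 2)) < η / 4 := by
      rw [div_lt_iff₀ (by positivity)]; nlinarith
    linarith
  have hL' : (0 : ℝ) < L := by exact_mod_cast hL
  rw [Finset.sum_sub_distrib, Finset.sum_const, Finset.card_univ, Fintype.card_fin, nsmul_eq_mul,
    mul_sub, inv_mul_cancel_left₀ hL'.ne'] at h3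
  have h6 := abs_lt.1 h3
  have h7 := abs_lt.1 (h4.trans_lt h5)
  rw [abs_lt]
  constructor <;> linarith

/-! ### From the recursion to convergence in distribution -/

/-- A tight family of laws on `ℕ` that asymptotically satisfies the recursion of the Poisson
weights converges to the Poisson law. -/
theorem tendsto_poisson_weight {ι : Type*} {l : Filter ι} {p : ι → ℕ → ℝ} {r : ℝ}
    (hp : ∀ k m, 0 ≤ p k m) (hle : ∀ k M, ∑ m ∈ Finset.range M, p k m ≤ 1) {C : ℝ}
    (htail : ∀ M : ℕ, 0 < M → ∀ᶠ k in l, 1 - C / M ≤ ∑ m ∈ Finset.range M, p k m)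
    (hrec : ∀ m : ℕ, Tendsto (fun k => (m + 1) * p k (m + 1) - r * p k m) l (nhds 0)) (m : ℕ) :
    Tendsto (fun k => p k m) l (nhds (Real.exp (-r) * r ^ m / m.factorial)) := by
  have h1 : ∀ m : ℕ, Tendsto (fun k => p k m - p k 0 * (r ^ m / m.factorial)) l (nhds 0) := by
    intro m
    induction m with
    | zero => simpa using tendsto_const_nhds
    | succ m ih =>
      have h := ((hrec m).add (ih.const_mul r)).div_const ((m : ℝ) + 1)
      rw [mul_zero, add_zero, zero_div] at h
      refine h.congr fun k => ?_
      have : ((m + 1).factorial : ℝ) = (m + 1) * m.factorial := by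
        push_cast [Nat.factorial_succ]; ring
      rw [this]
      have h2 : (m.factorial : ℝ) ≠ 0 := by positivity
      field_simp; ring
  have hp1 : ∀ k, p k 0 ≤ 1 := fun k => by simpa using hle k 1
  have hexp := (NormedSpace.expSeries_div_hasSum_exp r).tendsto_sum_nat
  rw [← Real.exp_eq_exp_ℝ] at hexp
  -- The recursion determines the weights up to the factor `p k 0`. Tightness excludes loss of mass
  -- at infinity: summing over `m < M`, the total is within `C / M` of `1` and the partial
  -- exponential sum is close to `exp r`.
  have h0 : Tendsto (fun k => p k 0 * Real.exp r) l (nhds 1) := by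
    rw [Metric.tendsto_nhds]
    intro η hη
    obtain ⟨M, hM0, hM1, hM2⟩ := ((eventually_gt_atTop 0).and
      ((eventually_div_natCast_lt C (by positivity : 0 < η / 3)).and
      ((Metric.tendsto_nhds.1 hexp) (η / 3) (by positivity)))).exists
    have hD := tendsto_finsetSum (Finset.range M) fun m _ => h1 m
    rw [Finset.sum_const_zero] at hD
    filter_upwards [htail M hM0, (Metric.tendsto_nhds.1 hD) (η / 3) (by positivity)] with k hk1 hk2
    rw [Real.dist_eq] at hM2 hk2 ⊢
    rw [sub_zero, Finset.sum_sub_distrib, ← Finset.mul_sum] at hk2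
    set A := ∑ m ∈ Finset.range M, r ^ m / (m.factorial : ℝ)
    have h3 := hle k M
    have h4 : |p k 0 * (A - Real.exp r)| < η / 3 := by
      rw [abs_mul, abs_of_nonneg (hp k 0)]
      exact (mul_le_of_le_one_left (abs_nonneg _) (hp1 k)).trans_lt hM2
    have h5 := abs_lt.1 h4
    have h6 := abs_lt.1 hk2
    rw [abs_lt]
    constructor <;> linarith
  have h00 : Tendsto (fun k => p k 0) l (nhds (Real.exp (-r))) := by
    have := h0.mul_const (Real.exp (-r))
    simpa [mul_assoc, ← Real.exp_add] using this
  have := (h1 m).add (h00.mul_const (r ^ m / m.factorial))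
  simpa [mul_div_assoc] using this

/-- Convergence of point masses of laws on `ℕ` implies weak convergence. -/
theorem tendsto_integral_of_tendsto_singleton {ι : Type*} {l : Filter ι} {ν : ι → Measure ℕ}
    [∀ k, IsProbabilityMeasure (ν k)] {ν' : Measure ℕ} [IsProbabilityMeasure ν']
    (h : ∀ m, Tendsto (fun k => (ν k).real {m}) l (nhds (ν'.real {m}))) {f : ℕ → ℝ} {C : ℝ}
    (hf : ∀ m, |f m| ≤ C) :
    Tendsto (fun k => ∫ m, f m ∂ν k) l (nhds (∫ m, f m ∂ν')) := by
  have hC : 0 ≤ C := (abs_nonneg _).trans (hf 0)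
  have hfi : ∀ (μ : Measure ℕ) [IsProbabilityMeasure μ], Integrable f μ := fun μ _ =>
    Integrable.of_bound (Measurable.of_discrete).aestronglyMeasurable C
      (ae_of_all _ fun m => by simpa using hf m)
  -- Truncation costs `C` times the tail mass. The tails of `ν k` need no separate assumption: the
  -- limit has total mass `1`, so convergence of finitely many point masses already makes them
  -- small.
  have htrunc : ∀ (μ : Measure ℕ) [IsProbabilityMeasure μ] (M : ℕ),
      |∫ m, f m ∂μ - ∑ m ∈ Finset.range M, μ.real {m} * f m|
        ≤ C * (1 - ∑ m ∈ Finset.range M, μ.real {m}) := by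
    intro μ _ M
    have hS : MeasurableSet (Finset.range M : Set ℕ) := .of_discrete
    have e1 : ∑ m ∈ Finset.range M, μ.real {m} * f m = ∫ m in (Finset.range M : Set ℕ), f m ∂μ := by
      rw [setIntegral_finset _ (hfi μ).integrableOn]; rfl
    rw [e1, sum_measureReal_singleton, ← setIntegral_compl hS (hfi μ),
      ← probReal_compl_eq_one_sub hS]
    exact norm_setIntegral_le_of_norm_le_const (f := f) (measure_lt_top μ _) fun m _ => hf m
  have htot : Tendsto (fun M => ∑ m ∈ Finset.range M, ν'.real {m}) atTop (nhds 1) := by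
    have h1 := tendsto_measure_iUnion_atTop (μ := ν') (s := fun M => (Finset.range M : Set ℕ))
      fun M N hMN => Finset.coe_subset.2 (Finset.range_mono hMN)
    have h2 : ⋃ M, (Finset.range M : Set ℕ) = Set.univ :=
      Set.eq_univ_of_forall fun m => Set.mem_iUnion.2 ⟨m + 1, by simp⟩
    rw [h2, measure_univ] at h1
    have h3 := (ENNReal.tendsto_toReal ENNReal.one_ne_top).comp h1
    rw [ENNReal.toReal_one] at h3
    refine h3.congr fun M => ?_
    rw [sum_measureReal_singleton]; rfl
  rw [Metric.tendsto_nhds]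
  intro η hη
  set θ := η / (4 * (C + 1)) with hθ
  have hθ0 : 0 < θ := by positivity
  obtain ⟨M, hM⟩ := ((htot.eventually_const_lt (by linarith : 1 - θ < 1))).exists
  have hs1 := tendsto_finsetSum (Finset.range M) fun m _ => h m
  have hs2 := tendsto_finsetSum (Finset.range M) fun m _ => (h m).mul_const (f m)
  filter_upwards [hs1.eventually_const_lt hM, (Metric.tendsto_nhds.1 hs2) (η / 4) (by positivity)]
    with k hk1 hk2
  rw [Real.dist_eq] at hk2 ⊢
  have t1 := abs_le.1 (htrunc (ν k) M)
  have t2 := abs_le.1 (htrunc ν' M)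
  have t3 := abs_lt.1 hk2
  have t4 : C * (1 - ∑ m ∈ Finset.range M, (ν k).real {m}) ≤ C * θ := by gcongr; linarith
  have t5 : C * (1 - ∑ m ∈ Finset.range M, ν'.real {m}) ≤ C * θ := by gcongr; linarith
  have t6 : C * θ ≤ η / 4 := by
    rw [hθ, ← mul_div_assoc, div_le_div_iff₀ (by positivity) (by positivity)]; nlinarith
  rw [abs_lt]
  constructor <;> linarith

theorem tendsto_hits_singleton {ι : Type*} {l : Filter ι} {n d : ι → ℕ}
    [∀ k, NeZero (d k)] (hn : Tendsto n l atTop) (hd : Tendsto d l atTop)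
    {x : (k : ι) → Fin (n k) → UnitSphere (d k)} (a : ℝ)
    (hx : ∀ ε : ℝ, 0 < ε →
      (fun k => correlationSum (x k) ε) =o[l] (fun k => (n k : ℝ) ^ 2))
    {I : Set ℝ} (hI : MeasurableSet I) (hIb : Bornology.IsBounded I) (m : ℕ) :
    Tendsto (fun k => ((uniformSphere (d k)).map (hits a (x k) I)).real {m}) l
      (nhds ((poissonMeasure
        (Real.toNNReal (gaussianPDFReal 0 1 a * volume.real I))).real {m})) := by
  set r := gaussianPDFReal 0 1 a * volume.real I with hrdef
  have hr : 0 ≤ r := mul_nonneg (gaussianPDFReal_nonneg _ _ _) measureReal_nonneg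
  rw [poissonMeasure_real_singleton, Real.coe_toNNReal _ hr]
  have hmeas : ∀ k, Measurable (hits a (x k) I) := fun k => measurable_hits a (x k) hI
  have hprob : ∀ k, IsProbabilityMeasure ((uniformSphere (d k)).map (hits a (x k) I)) := fun k =>
    Measure.isProbabilityMeasure_map (hmeas k).aemeasurable
  refine tendsto_poisson_weight (C := r + 1) (fun k m => measureReal_nonneg) (fun k M => ?_)
    (fun M hM => ?_) (fun m => ?_) m
  · rw [sum_measureReal_singleton]; exact measureReal_le_one
  -- Tightness by Markov's inequality: the mean count is eventually at most `r + 1`.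
  · have h1 := (tendsto_first_moment hn hd (x := x) a hI hIb).eventually_le_const
      (lt_add_one r)
    filter_upwards [h1] with k hk
    rw [← integral_hits a (x k) hI] at hk
    have hM' : (0 : ℝ) < M := by exact_mod_cast hM
    have hS : MeasurableSet (Finset.range M : Set ℕ) := .of_discrete
    rw [sum_measureReal_singleton, sub_le_comm, ← probReal_compl_eq_one_sub hS,
      map_measureReal_apply (hmeas k) hS.compl, le_div_iff₀ hM', mul_comm]
    refine le_trans (le_trans (le_of_eq ?_) (mul_meas_ge_le_integral_of_nonneg
      (μ := uniformSphere (d k)) (ae_of_all _ fun u => Nat.cast_nonneg (hits a (x k) I u))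
      ((memLp_hits a (x k) hI).integrable one_le_two) M)) hk
    congr 2
    ext u; simp
  · refine (tendsto_succ_mul_sub hn hd a hx hI hIb m).congr fun k => ?_
    rw [map_measureReal_apply (hmeas k) (measurableSet_singleton _),
      map_measureReal_apply (hmeas k) (measurableSet_singleton _)]
    rfl

theorem mainTheorem1 {ι : Type*} (l : Filter ι) (n d : ι → ℕ) [∀ k, NeZero (d k)]
    (hn : Tendsto n l atTop) (hd : Tendsto d l atTop)
    (x : (k : ι) → Fin (n k) → UnitSphere (d k))
    (hx : ∀ ε : ℝ, 0 < ε →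
      (fun k => correlationSum (x k) ε) =o[l] (fun k => (n k : ℝ) ^ 2))
    (a : ℝ) (I : Set ℝ) (hI : MeasurableSet I) (hIb : Bornology.IsBounded I) :
    TendstoInDistribution
      (fun k (U : UnitSphere (d k)) => (projectionProcess (x k) a U).real I) l
      (fun m : ℕ => (m : ℝ))
      (fun k => uniformSphere (d k))
      (poissonMeasure (Real.toNNReal (gaussianPDFReal 0 1 a * volume.real I))) := by
  have hmeas : ∀ k, Measurable (hits a (x k) I) := fun k => measurable_hits a (x k) hI
  have hprob : ∀ k, IsProbabilityMeasure ((uniformSphere (d k)).map (hits a (x k) I)) := fun k =>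
    Measure.isProbabilityMeasure_map (hmeas k).aemeasurable
  have hcast : Measurable (Nat.cast : ℕ → ℝ) := .of_discrete
  have hX : ∀ k, (fun U : UnitSphere (d k) => (projectionProcess (x k) a U).real I)
      = fun U => (hits a (x k) I U : ℝ) := fun k =>
    funext fun U => projectionProcess_real_eq_hits a (x k) hI U
  have hXm : ∀ k, Measurable fun U : UnitSphere (d k) => (projectionProcess (x k) a U).real I :=
    fun k => by rw [hX]; exact hcast.comp (hmeas k)
  refine ⟨fun k => (hXm k).aemeasurable, hcast.aemeasurable, ?_⟩
  refine ProbabilityMeasure.tendsto_iff_forall_integral_tendsto.2 fun f => ?_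
  have h := tendsto_integral_of_tendsto_singleton
    (tendsto_hits_singleton hn hd a hx hI hIb) (f := fun m => f m) (C := ‖f‖)
    fun m => f.norm_coe_le_norm _
  have hfm := f.continuous.measurable
  convert! h using 1
  · funext k
    change ∫ ω, f ω ∂(Measure.map _ _) = _
    rw [integral_map (hXm k).aemeasurable hfm.aestronglyMeasurable,
      integral_map (hmeas k).aemeasurable (Measurable.of_discrete).aestronglyMeasurable]
    simp only [projectionProcess_real_eq_hits a (x k) hI]
  · congr 1
    exact integral_map hcast.aemeasurable hfm.aestronglyMeasurable
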